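/- Let $a,c<0$ and $b,b_2,a_2,c_2>0$, let $\omega\in\mathbb R$ satisfy $$0<|\omega|<\min\left\{1,\frac{-a}{b},\frac{-c}{b},\frac{a_2}{b_2},\frac{c_2}{b_2}\right\},$$ and let $F:\mathbb R^4\to\mathbb R$ be of class $C^2$ with $F(0)=0$. Put $G(w)=w\cdot\nabla F(w)$ and assume: (a) there is $p>0$ such that $w\cdot\nabla G(w)\ge (p+2)\,G(w)$ for all $w\in\mathbb R^4$; (b) there are $0<q_1\le q_2<\infty$ and $C>0$ such that $|D^2F(w)|\le C\left(|w|^{q_1}+|w|^{q_2}\right)$ for all $w\in\mathbb R^4$; (c) there are $u,v\in H^2(\mathbb R)$ such that $\int_{\mathbb R}F(u,u',v,v')\,dx>0$. On $X=H^2(\mathbb R)\times H^2(\mathbb R)$ (real-valued functions) define $$I_\omega(\psi,v)=\int_{\mathbb R}\left[\psi^2-c(\psi')^2+c_2(\psi'')^2+v^2-a(v')^2+a_2(v'')^2\right]dx-2\omega\int_{\mathbb R}\left(\psi v+b\psi'v'+b_2\psi''v''\right)dx,$$ $$K(\psi,v)=\int_{\mathbb R}F(\psi,\psi',v,v')\,dx,\qquad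 N(\psi,v)=\int_{\mathbb R}G(\psi,\psi',v,v')\,dx,$$ $$J_\omega=\tfrac12 I_\omega-K,\qquad P_\omega=I_\omega-N,$$ $$\mathcal M_\omega=\{\Psi\in X: P_\omega(\Psi)=0\},\qquad S(\omega)=\inf\{J_\omega(\Psi):\Psi\in\mathcal M_\omega\setminus\{0\}\}.$$ Then $\mathcal M_\omega\setminus\{0\}$ is nonempty and $J_\omega$ is bounded below on it, so $S(\omega)$ is a real number. Moreover, for every minimizing sequence $(\psi_n,v_n)_n$ of $S(\omega)$, that is, $(\psi_n,v_n)\in\mathcal M_\omega\setminus\{0\}$ for all $n$ and $J_\omega(\psi_n,v_n)\to S(\omega)$, there exist a subsequence $(\psi_{n_k},v_{n_k})_k$, points $y_k\in\mathbb R$ and $(\psi_0,v_0)\in\mathcal M_\omega\setminus\{0\}$ such that $$\left(\psi_{n_k}(\cdot+y_k),\,v_{n_k}(\cdot+y_k)\right)\to(\psi_0,v_0)\quad\text{strongly in } X \text{ as } k\to\infty,$$ and $J_\omega(\psi_0,v_0)=S(\omega)$; that is, $(\psi_0,v_0)$ minimizes $J_\omega$ over $\mathcal M_\omega\setminus\{0\}$.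 Furthermore $(\psi_0,v_0)$ is a critical point of $J_\omega$ on $X$ (that is, $J_\omega$ is Fréchet differentiable at $(\psi_0,v_0)$ and $J_\omega'(\psi_0,v_0)=0$), which by definition means that it is a weak solution of the traveling-wave system $$\begin{cases}-\omega\left(v-bv''+b_2v^{(iv)}\right)+\psi+c\psi''+c_2\psi^{(iv)}=F_q-\left(F_r\right)_x,\\[2pt]-\omega\left(\psi-b\psi''+b_2\psi^{(iv)}\right)+v+av''+a_2v^{(iv)}=F_s-\left(F_t\right)_x,\end{cases}$$ where the partial derivatives of $F=F(q,r,s,t)$ are evaluated at $(\psi,\psi',v,v')$. -/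

import Mathlib

open MeasureTheory Filter Topology

noncomputable section

namespace Boussinesq

/-- `L²(ℝ)`, real valued, with respect to Lebesgue measure. -/
abbrev L2 : Type := Lp ℝ 2 (volume : Measure ℝ)

/-- `g` is the weak (distributional) derivative of `f` on `ℝ`. -/
def IsWeakDeriv (f g : L2) : Prop :=
  ∀ φ : ℝ → ℝ, ContDiff ℝ (⊤ : ℕ∞) φ → HasCompactSupport φ →
    ∫ x, f x * deriv φ x = -∫ x, g x * φ x

lemma integrable_mul_test (f : L2) {φ : ℝ → ℝ} (hφ : Continuous φ) (hc : HasCompactSupport φ) :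
    Integrable (fun x => f x * φ x) :=
  (Lp.memLp f).integrable_mul (hφ.memLp_of_hasCompactSupport (p := 2) hc)

lemma integral_add_mul_test (f g : L2) {φ : ℝ → ℝ} (hφ : Continuous φ)
    (hc : HasCompactSupport φ) :
    ∫ x, (f + g : L2) x * φ x = (∫ x, f x * φ x) + ∫ x, g x * φ x := by
  rw [← integral_add (integrable_mul_test f hφ hc) (integrable_mul_test g hφ hc)]
  refine integral_congr_ae ?_
  filter_upwards [Lp.coeFn_add f g] with x hx
  rw [hx, Pi.add_apply, add_mul]

lemma integral_smul_mul_test (r : ℝ) (f : L2) (φ : ℝ → ℝ) :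
    ∫ x, (r • f : L2) x * φ x = r * ∫ x, f x * φ x := by
  rw [← integral_const_mul]
  refine integral_congr_ae ?_
  filter_upwards [Lp.coeFn_smul r f] with x hx
  rw [hx, Pi.smul_apply, smul_eq_mul, mul_assoc]

lemma isWeakDeriv_zero : IsWeakDeriv 0 0 := by
  intro φ _ _
  have h : ∀ χ : ℝ → ℝ, ∫ x, (0 : L2) x * χ x = 0 := by
    intro χ
    simpa only [zero_smul, zero_mul] using integral_smul_mul_test 0 0 χ
  rw [h, h, neg_zero]

lemma IsWeakDeriv.add {f g f₁ g₁ : L2} (h : IsWeakDeriv f f₁) (k : IsWeakDeriv g g₁) :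
    IsWeakDeriv (f + g) (f₁ + g₁) := by
  intro φ hφ hc
  rw [integral_add_mul_test f g (hφ.continuous_deriv (by simp)) hc.deriv,
    integral_add_mul_test f₁ g₁ hφ.continuous hc, h φ hφ hc, k φ hφ hc]
  ring

lemma IsWeakDeriv.smul (r : ℝ) {f f₁ : L2} (h : IsWeakDeriv f f₁) :
    IsWeakDeriv (r • f) (r • f₁) := by
  intro φ hφ hc
  rw [integral_smul_mul_test, integral_smul_mul_test, h φ hφ hc]
  ring

/-- The Sobolev space `H²(ℝ)`: a function `u` is represented by the triple `(u, u', u'')` of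
`L²` functions, `u'` and `u''` being its weak derivatives. The norm inherited from the `ℓ²`-sum is
`‖u‖² = ‖u‖²_{L²} + ‖u'‖²_{L²} + ‖u''‖²_{L²}`. -/
def H2 : Submodule ℝ (PiLp 2 fun _ : Fin 3 => L2) where
  carrier := {U | IsWeakDeriv (U 0) (U 1) ∧ IsWeakDeriv (U 1) (U 2)}
  add_mem' := fun h k => ⟨h.1.add k.1, h.2.add k.2⟩
  zero_mem' := ⟨isWeakDeriv_zero, isWeakDeriv_zero⟩
  smul_mem' := fun r _ h => ⟨h.1.smul r, h.2.smul r⟩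

/-- The `i`-th weak derivative (`i = 0, 1, 2`) of an element of `H²(ℝ)`. -/
def D (u : H2) (i : Fin 3) : L2 := (u : PiLp 2 fun _ : Fin 3 => L2) i

/-- The translate `f(· + y)` of an `L²` function. -/
def shift (y : ℝ) (f : L2) : L2 :=
  Lp.compMeasurePreserving (fun x => x + y) (measurePreserving_add_right volume y) f

lemma integral_shift_mul (y : ℝ) (f : L2) (φ : ℝ → ℝ) :
    ∫ x, shift y f x * φ x = ∫ x, f x * φ (x - y) := by
  rw [← integral_add_right_eq_self (fun x => f x * φ (x - y)) y]
  refine integral_congr_ae ?_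
  filter_upwards [Lp.coeFn_compMeasurePreserving f (measurePreserving_add_right volume y)]
    with x hx
  rw [shift, hx]
  simp

lemma IsWeakDeriv.shift (y : ℝ) {f f₁ : L2} (h : IsWeakDeriv f f₁) :
    IsWeakDeriv (shift y f) (shift y f₁) := by
  intro φ hφ hc
  have hφ' : ContDiff ℝ (⊤ : ℕ∞) (fun x => φ (x - y)) := hφ.comp (contDiff_id.sub contDiff_const)
  have hc' : HasCompactSupport (fun x => φ (x - y)) :=
    hc.comp_homeomorph (Homeomorph.subRight y)
  have := h _ hφ' hc'
  rw [integral_shift_mul, integral_shift_mul, ← this]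
  simp_rw [deriv_comp_sub_const]

/-- The translate `u(· + y)` of an element of `H²(ℝ)`. -/
def H2translate (y : ℝ) (u : H2) : H2 :=
  ⟨WithLp.toLp 2 fun i => shift y (D u i), u.2.1.shift y, u.2.2.shift y⟩

/-- The energy space `X = H²(ℝ) × H²(ℝ)`. -/
abbrev X : Type := H2 × H2

/-- The translate `(ψ(· + y), v(· + y))`. -/
def translate (y : ℝ) (Ψ : X) : X := (H2translate y Ψ.1, H2translate y Ψ.2)

abbrev R4 : Type := EuclideanSpace ℝ (Fin 4)

/-- `x ↦ (ψ(x), ψ'(x), v(x), v'(x))`. -/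
def jet (Ψ : X) (x : ℝ) : R4 := !₂[D Ψ.1 0 x, D Ψ.1 1 x, D Ψ.2 0 x, D Ψ.2 1 x]

/-- `G(w) = w · ∇F(w)`. -/
def G (F : R4 → ℝ) (w : R4) : ℝ := fderiv ℝ F w w

def I₁ (a c a₂ c₂ : ℝ) (Ψ : X) : ℝ :=
  ∫ x, ((D Ψ.1 0 x) ^ 2 - c * (D Ψ.1 1 x) ^ 2 + c₂ * (D Ψ.1 2 x) ^ 2
    + (D Ψ.2 0 x) ^ 2 - a * (D Ψ.2 1 x) ^ 2 + a₂ * (D Ψ.2 2 x) ^ 2)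

def I₂ (b b₂ : ℝ) (Ψ : X) : ℝ :=
  ∫ x, (D Ψ.1 0 x * D Ψ.2 0 x + b * (D Ψ.1 1 x * D Ψ.2 1 x) + b₂ * (D Ψ.2 2 x * D Ψ.1 2 x))

/-- `I_ω = I₁ - 2 ω I₂`. -/
def I (a b c a₂ b₂ c₂ ω : ℝ) (Ψ : X) : ℝ := I₁ a c a₂ c₂ Ψ + -2 * ω * I₂ b b₂ Ψ

/-- `K(ψ, v) = ∫ F(ψ, ψ', v, v') dx`. -/
def K (F : R4 → ℝ) (Ψ : X) : ℝ := ∫ x, F (jet Ψ x)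

/-- `N(ψ, v) = ∫ (ψ, ψ', v, v') · ∇F(ψ, ψ', v, v') dx`. -/
def N (F : R4 → ℝ) (Ψ : X) : ℝ := ∫ x, G F (jet Ψ x)

/-- `J_ω = ½ I_ω - K`. -/
def J (a b c a₂ b₂ c₂ ω : ℝ) (F : R4 → ℝ) (Ψ : X) : ℝ :=
  1 / 2 * I a b c a₂ b₂ c₂ ω Ψ - K F Ψ

/-- `P_ω = I_ω - N`. -/
def P (a b c a₂ b₂ c₂ ω : ℝ) (F : R4 → ℝ) (Ψ : X) : ℝ :=
  I a b c a₂ b₂ c₂ ω Ψ - N F Ψ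

/-- The manifold `{P_ω = 0}` in `X`. -/
def M (a b c a₂ b₂ c₂ ω : ℝ) (F : R4 → ℝ) : Set X := {Ψ | P a b c a₂ b₂ c₂ ω F Ψ = 0}

/-- `S(ω) = inf {J_ω(Ψ) : P_ω(Ψ) = 0, Ψ ≠ 0}`. The zero function trivially satisfies `P_ω = 0`
and is not admitted as a competitor. -/
def S (a b c a₂ b₂ c₂ ω : ℝ) (F : R4 → ℝ) : ℝ :=
  sInf (J a b c a₂ b₂ c₂ ω F '' (M a b c a₂ b₂ c₂ ω F \ {0}))

/-- A weak solution of the traveling-wave system is a critical point of `J_ω` on `X`: the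
functional `J_ω` is Fréchet differentiable there with derivative zero. -/
def IsWeakSolution (a b c a₂ b₂ c₂ ω : ℝ) (F : R4 → ℝ) (Ψ : X) : Prop :=
  HasFDerivAt (J a b c a₂ b₂ c₂ ω F) (0 : X →L[ℝ] ℝ) Ψ

/-- A minimizing sequence for `S(ω)`. -/
def IsMinimizingSeq (a b c a₂ b₂ c₂ ω : ℝ) (F : R4 → ℝ) (Ψ : ℕ → X) : Prop :=
  (∀ n, Ψ n ∈ M a b c a₂ b₂ c₂ ω F \ {0}) ∧
    Tendsto (fun n => J a b c a₂ b₂ c₂ ω F (Ψ n)) atTop (𝓝 (S a b c a₂ b₂ c₂ ω F))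

end Boussinesq

end

/-! On the Nehari manifold the action agrees with the reduced action `J - P / (p + 2)`, which equals
`(1/2 - 1/(p+2)) I + (1/(p+2)) ∫ (G - (p+2) F)`. The radial hypothesis makes `G - (p+2) F`
nonnegative and nondecreasing along rays, and the bound on `ω` makes `I` coercive. So the reduced
action controls the squared norm, and minimizing sequences are bounded. Moreover a nonzero state
with `P ≤ 0` can be scaled down onto the manifold without increasing its reduced action, so its
reduced action is still at least `S` (`le_reducedAction_of_nehari_nonpos`).

Compactness up to translation (`exists_translate_tendsto`): since `G` is `o(|w|²)` at the origin,
the jets of nonzero states with `P ≤ 0` cannot be uniformly small (`exists_le_norm_jetL`).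
Translating a point of largeness to the origin gives a nonzero weak limit, because evaluating `u`
and `u'` at a point is continuous on `H²`. Along a weakly convergent sequence `I`, `K` and `N` split
into the contribution of the limit and that of the remainder. If the limit has `P ≤ 0`, it already
uses up the whole level `S`, so the remainder has vanishing reduced action and tends to zero in
norm. If it has `P > 0`, the remainders have `P < 0` and use up the level `S` themselves, which
leaves nothing for the nonzero limit.

A minimizer is critical without Lagrange multipliers (`hasFDerivAt_action_of_isMin`): it maximizes
the action along its own ray, so a descent direction would produce, after rescaling back to the
manifold, a competitor of smaller action.

The growth at infinity is harmless: jets are bounded by the norm of the state, so only bounds of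
`D²F` on balls enter, together with their decay as the radius tends to zero. -/

noncomputable section

namespace Boussinesq

/-! ### Pointwise properties of the nonlinearity -/

/-- `f` vanishes at the origin and is Lipschitz on each ball `‖x‖ ≤ M`, with a constant that is
linear in the distance of the points to the origin. -/
structure QuadLip (B : ℝ → ℝ) (f : R4 → ℝ) : Prop where
  zero : f 0 = 0
  lip : ∀ (M : ℝ) (x y : R4), ‖x‖ ≤ M → ‖y‖ ≤ M →
    |f x - f y| ≤ B M * ((‖x‖ + ‖y‖) * ‖x - y‖)

lemma QuadLip.abs_le {B : ℝ → ℝ} {f : R4 → ℝ} (h : QuadLip B f) {M : ℝ} {x : R4} (hx : ‖x‖ ≤ M) :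
    |f x| ≤ B M * ‖x‖ ^ 2 := by
  have := h.lip M x 0 hx (by simpa using (norm_nonneg x).trans hx)
  simpa [h.zero, pow_two] using this

lemma QuadLip.continuous {B : ℝ → ℝ} {f : R4 → ℝ} (h : QuadLip B f) : Continuous f := by
  rw [continuous_iff_continuousAt]
  intro x
  rw [ContinuousAt, tendsto_iff_norm_sub_tendsto_zero]
  have hlim : Tendsto (fun y : R4 => B (‖x‖ + 1) * ((‖y‖ + ‖x‖) * ‖y - x‖)) (𝓝 x) (𝓝 0) := by
    have : Continuous (fun y : R4 => B (‖x‖ + 1) * ((‖y‖ + ‖x‖) * ‖y - x‖)) := by fun_prop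
    simpa using this.tendsto x
  refine squeeze_zero' (Eventually.of_forall fun _ => norm_nonneg _) ?_ hlim
  have : ∀ᶠ y : R4 in 𝓝 x, ‖y‖ < ‖x‖ + 1 :=
    continuous_norm.continuousAt.eventually_lt continuousAt_const (by simp)
  filter_upwards [this] with y hy
  exact h.lip _ y x hy.le (by simp)

/-- Failure of additivity of a `QuadLip` function is controlled by the product of the norms. -/
lemma QuadLip.abs_add_sub_sub_le {B : ℝ → ℝ} {f : R4 → ℝ} (h : QuadLip B f) {M : ℝ} (hB : 0 ≤ B M)
    {x y : R4} (hx : ‖x‖ ≤ M) (hy : ‖y‖ ≤ M) (hxy : ‖x + y‖ ≤ M) :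
    |f (x + y) - f x - f y| ≤ 4 * B M * (‖x‖ * ‖y‖) := by
  -- The larger vector serves as base point, so that the square of the smaller norm is absorbed into
  -- the product.
  wlog hle : ‖y‖ ≤ ‖x‖ generalizing x y
  · have := this hy hx (by rwa [add_comm]) (le_of_not_ge hle)
    rw [add_comm y x] at this
    rw [mul_comm ‖x‖]
    convert this using 2
    ring
  have h1 := h.lip M (x + y) x hxy hx
  have h2 := h.abs_le hy
  rw [add_sub_cancel_left] at h1
  have h3 : (‖x + y‖ + ‖x‖) * ‖y‖ ≤ 3 * (‖x‖ * ‖y‖) := by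
    have := norm_add_le x y
    nlinarith [norm_nonneg y]
  have h4 : ‖y‖ ^ 2 ≤ ‖x‖ * ‖y‖ := by nlinarith [norm_nonneg y]
  calc |f (x + y) - f x - f y| ≤ |f (x + y) - f x| + |f y| := abs_sub _ _
    _ ≤ B M * (3 * (‖x‖ * ‖y‖)) + B M * (‖x‖ * ‖y‖) :=
        add_le_add (h1.trans (mul_le_mul_of_nonneg_left h3 hB))
          (h2.trans (mul_le_mul_of_nonneg_left h4 hB))
    _ = _ := by ring

/-- The standing assumptions on the nonlinearity, with explicit constants. -/
structure Nonlinearity (F : R4 → ℝ) (p q₁ q₂ C : ℝ) : Prop where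
  contDiff : ContDiff ℝ 2 F
  zero : F 0 = 0
  p_pos : 0 < p
  radial : ∀ w : R4, (p + 2) * G F w ≤ fderiv ℝ (G F) w w
  q₁_pos : 0 < q₁
  q_le : q₁ ≤ q₂
  C_pos : 0 < C
  growth : ∀ w : R4, ‖iteratedFDeriv ℝ 2 F w‖ ≤ C * (‖w‖ ^ q₁ + ‖w‖ ^ q₂)

/-- The growth bound of the second derivative on the ball of radius `M`. -/
def growthBound (q₁ q₂ C M : ℝ) : ℝ := C * (M ^ q₁ + M ^ q₂)

namespace Nonlinearity

variable {F : R4 → ℝ} {p q₁ q₂ C : ℝ} (hF : Nonlinearity F p q₁ q₂ C)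
include hF

lemma growthBound_nonneg {M : ℝ} (hM : 0 ≤ M) : 0 ≤ growthBound q₁ q₂ C M := by
  have := hF.C_pos
  unfold growthBound
  positivity

lemma tendsto_growthBound : Tendsto (growthBound q₁ q₂ C) (𝓝 0) (𝓝 0) := by
  have h2 : 0 < q₂ := hF.q₁_pos.trans_le hF.q_le
  have : Continuous (growthBound q₁ q₂ C) := by
    unfold growthBound
    exact continuous_const.mul ((Real.continuous_rpow_const hF.q₁_pos.le).add
      (Real.continuous_rpow_const h2.le))
  simpa [growthBound, Real.zero_rpow hF.q₁_pos.ne', Real.zero_rpow h2.ne'] using this.tendsto 0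

lemma differentiable : Differentiable ℝ F := hF.contDiff.differentiable (by norm_num)

lemma contDiff_fderiv : ContDiff ℝ 1 (fderiv ℝ F) := hF.contDiff.fderiv_right (by norm_num)

lemma differentiable_fderiv : Differentiable ℝ (fderiv ℝ F) :=
  hF.contDiff_fderiv.differentiable (by norm_num)

lemma hasFDerivAt_G (w : R4) :
    HasFDerivAt (G F) ((fderiv ℝ (fderiv ℝ F) w).flip w + fderiv ℝ F w) w := by
  have := (hF.differentiable_fderiv w).hasFDerivAt.clm_apply (hasFDerivAt_id w)
  exact this.congr_fderiv (by ext v; simp [add_comm])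

lemma norm_fderiv_fderiv_le {M : ℝ} {w : R4} (hw : ‖w‖ ≤ M) :
    ‖fderiv ℝ (fderiv ℝ F) w‖ ≤ growthBound q₁ q₂ C M := by
  have h0 := norm_nonneg w
  have hq1 := hF.q₁_pos
  have hq2 : 0 < q₂ := hF.q₁_pos.trans_le hF.q_le
  have hC := hF.C_pos
  rw [← norm_iteratedFDeriv_one, norm_iteratedFDeriv_fderiv]
  refine (hF.growth w).trans ?_
  unfold growthBound
  gcongr

lemma norm_fderiv_sub_le {M : ℝ} {x y : R4} (hx : ‖x‖ ≤ M) (hy : ‖y‖ ≤ M) :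
    ‖fderiv ℝ F x - fderiv ℝ F y‖ ≤ growthBound q₁ q₂ C M * ‖x - y‖ :=
  Convex.norm_image_sub_le_of_norm_fderiv_le (s := Metric.closedBall 0 M)
    (fun z _ => hF.differentiable_fderiv z)
    (fun z hz => hF.norm_fderiv_fderiv_le (by simpa using hz)) (convex_closedBall _ _)
    (by simpa using hy) (by simpa using hx)

/-- Inserting `w = t h` into the radial inequality and dividing by `t > 0` gives `t D²F(th)(h,h) ≥
(p+1) DF(th)h`. Letting `t → 0` yields `DF(0)h ≤ 0`, and replacing `h` by `-h` gives equality. This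
is what makes `F` and `G` quadratically small at the origin. -/
lemma fderiv_zero : fderiv ℝ F 0 = 0 := by
  have key : ∀ h : R4, fderiv ℝ F 0 h ≤ 0 := by
    intro h
    have hc : Continuous fun t : ℝ =>
        t * fderiv ℝ (fderiv ℝ F) (t • h) h h - (p + 1) * fderiv ℝ F (t • h) h := by
      have h1 := hF.contDiff_fderiv.continuous
      have h2 := hF.contDiff_fderiv.continuous_fderiv (by norm_num)
      have h3 : Continuous fun t : ℝ => fderiv ℝ (fderiv ℝ F) (t • h) h h :=
        ((h2.comp (by fun_prop : Continuous fun t : ℝ => t • h)).clm_apply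
          continuous_const).clm_apply continuous_const
      have h4 : Continuous fun t : ℝ => fderiv ℝ F (t • h) h :=
        (h1.comp (by fun_prop : Continuous fun t : ℝ => t • h)).clm_apply continuous_const
      fun_prop
    have hlim := (hc.tendsto 0).mono_left (nhdsWithin_le_nhds (s := Set.Ioi 0))
    have hge : ∀ᶠ t : ℝ in 𝓝[>] 0,
        0 ≤ t * fderiv ℝ (fderiv ℝ F) (t • h) h h - (p + 1) * fderiv ℝ F (t • h) h := by
      filter_upwards [self_mem_nhdsWithin] with t (ht : 0 < t)
      have := hF.radial (t • h)
      rw [(hF.hasFDerivAt_G _).fderiv] at this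
      simp only [G, map_smul, add_apply, ContinuousLinearMap.flip_apply,
        smul_apply, smul_eq_mul] at this
      have h2 : 0 ≤ t * (t * fderiv ℝ (fderiv ℝ F) (t • h) h h
          - (p + 1) * fderiv ℝ F (t • h) h) := by linarith
      exact nonneg_of_mul_nonneg_right h2 ht
    have := ge_of_tendsto hlim hge
    simp only [zero_mul, zero_smul, zero_sub] at this
    have hp := hF.p_pos
    nlinarith
  ext h
  have h1 := key h
  have h2 := key (-h)
  simp only [map_neg] at h2
  simpa using le_antisymm h1 (by linarith)

lemma norm_fderiv_le {M : ℝ} {x : R4} (hx : ‖x‖ ≤ M) :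
    ‖fderiv ℝ F x‖ ≤ growthBound q₁ q₂ C M * ‖x‖ := by
  simpa [hF.fderiv_zero] using
    hF.norm_fderiv_sub_le hx (y := 0) (by simpa using (norm_nonneg x).trans hx)

/-- Mean value inequality for `F - DF(z)` on the segment from `y` to `x`. The base point `z` is kept
separate from both ends because strict differentiability of the integral functional is needed later.
-/
lemma abs_sub_sub_fderiv_le {M : ℝ} {x y z : R4} (hx : ‖x‖ ≤ M) (hy : ‖y‖ ≤ M) (hz : ‖z‖ ≤ M) :
    |F x - F y - fderiv ℝ F z (x - y)|
      ≤ growthBound q₁ q₂ C M * ((‖x - z‖ + ‖y - z‖) * ‖x - y‖) := by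
  have hM := (norm_nonneg x).trans hx
  have hsub : segment ℝ y x ⊆ Metric.closedBall 0 M :=
    (convex_closedBall _ _).segment_subset (by simpa using hy) (by simpa using hx)
  have hsub' : segment ℝ y x ⊆ Metric.closedBall z (‖x - z‖ + ‖y - z‖) :=
    (convex_closedBall _ _).segment_subset (by simp [dist_eq_norm]) (by simp [dist_eq_norm])
  have := Convex.norm_image_sub_le_of_norm_fderiv_le' (s := segment ℝ y x)
    (f := F) (φ := fderiv ℝ F z) (C := growthBound q₁ q₂ C M * (‖x - z‖ + ‖y - z‖))
    (x := y) (y := x) (fun ξ _ => hF.differentiable ξ)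
    (fun ξ hξ => (hF.norm_fderiv_sub_le (by simpa using hsub hξ) hz).trans
      (mul_le_mul_of_nonneg_left (by simpa [dist_eq_norm] using hsub' hξ)
        (hF.growthBound_nonneg hM)))
    (convex_segment _ _) (left_mem_segment _ _ _) (right_mem_segment _ _ _)
  simpa [mul_assoc] using this

lemma quadLip_F : QuadLip (growthBound q₁ q₂ C) F where
  zero := hF.zero
  lip M x y hx hy := by
    have hM := (norm_nonneg x).trans hx
    have h1 := hF.growthBound_nonneg hM
    have := Convex.norm_image_sub_le_of_norm_fderiv_le (s := Metric.closedBall 0 (max ‖x‖ ‖y‖))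
      (f := F) (𝕜 := ℝ) (C := growthBound q₁ q₂ C M * (‖x‖ + ‖y‖)) (x := y) (y := x)
      (fun z _ => hF.differentiable z)
      (fun z hz => by
        have hz' : ‖z‖ ≤ max ‖x‖ ‖y‖ := by simpa using hz
        refine (hF.norm_fderiv_le (hz'.trans (max_le hx hy))).trans
          (mul_le_mul_of_nonneg_left (hz'.trans ?_) h1)
        exact max_le (by simp) (by simp))
      (convex_closedBall _ _) (by simp) (by simp)
    simpa [mul_assoc] using this

/-- Only first differences of `DF` enter, through the splitting `G x - G y = DF(x)(x - y) + (DF(x) -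
DF(y)) y`. -/
lemma quadLip_G : QuadLip (growthBound q₁ q₂ C) (G F) where
  zero := by simp [G]
  lip M x y hx hy := by
    have h1 : G F x - G F y = fderiv ℝ F x (x - y) + (fderiv ℝ F x - fderiv ℝ F y) y := by
      simp [G]
    have h2 : |fderiv ℝ F x (x - y)| ≤ growthBound q₁ q₂ C M * ‖x‖ * ‖x - y‖ :=
      ((fderiv ℝ F x).le_opNorm _).trans
        (mul_le_mul_of_nonneg_right (hF.norm_fderiv_le hx) (norm_nonneg _))
    have h3 : |(fderiv ℝ F x - fderiv ℝ F y) y| ≤ growthBound q₁ q₂ C M * ‖x - y‖ * ‖y‖ :=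
      ((fderiv ℝ F x - fderiv ℝ F y).le_opNorm _).trans
        (mul_le_mul_of_nonneg_right (hF.norm_fderiv_sub_le hx hy) (norm_nonneg _))
    rw [h1]
    refine (abs_add_le _ _).trans ((add_le_add h2 h3).trans (le_of_eq ?_))
    ring

/-- The derivative in `t` is `t ^ (-(p+3))` times `DG(tw)(tw) - (p+2) G(tw)`, which the radial
hypothesis makes nonnegative. -/
lemma G_ray_monotoneOn (w : R4) :
    MonotoneOn (fun t : ℝ => G F (t • w) * t ^ (-(p + 2))) (Set.Ioi 0) := by
  have hd : ∀ t : ℝ, 0 < t → HasDerivAt (fun t : ℝ => G F (t • w) * t ^ (-(p + 2)))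
      (fderiv ℝ (G F) (t • w) w * t ^ (-(p + 2))
        + G F (t • w) * (-(p + 2) * t ^ (-(p + 2) - 1))) t := by
    intro t ht
    have h1 : HasDerivAt (fun t : ℝ => t • w) w t := by
      simpa using (hasDerivAt_id t).smul_const w
    have h2 := (hF.hasFDerivAt_G (t • w)).differentiableAt.hasFDerivAt.comp_hasDerivAt t h1
    exact h2.mul (Real.hasDerivAt_rpow_const (Or.inl ht.ne'))
  refine monotoneOn_of_deriv_nonneg (convex_Ioi 0)
    (fun t ht => (hd t ht).continuousAt.continuousWithinAt)
    (fun t ht => (hd t (by simpa using ht)).differentiableAt.differentiableWithinAt) ?_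
  intro t ht
  have ht : 0 < t := by simpa using ht
  rw [(hd t ht).deriv]
  have h1 := hF.radial (t • w)
  rw [map_smul, smul_eq_mul] at h1
  have h2 : t ^ (-(p + 2)) = t ^ (-(p + 2) - 1) * t := by
    rw [← Real.rpow_add_one ht.ne']; ring_nf
  have h3 : 0 < t ^ (-(p + 2) - 1) := by positivity
  rw [h2]
  nlinarith

lemma rpow_mul_G_le {t : ℝ} (ht : 1 ≤ t) (w : R4) : t ^ (p + 2) * G F w ≤ G F (t • w) := by
  have ht0 : 0 < t := by linarith
  have := hF.G_ray_monotoneOn w (Set.mem_Ioi.2 one_pos) (Set.mem_Ioi.2 ht0) ht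
  simp only [one_smul, Real.one_rpow, mul_one, Real.rpow_neg ht0.le] at this
  rw [← div_eq_mul_inv, le_div_iff₀ (by positivity)] at this
  linarith

lemma G_smul_le {t : ℝ} (ht0 : 0 < t) (ht : t ≤ 1) (w : R4) :
    G F (t • w) ≤ t ^ (p + 2) * G F w := by
  have := hF.G_ray_monotoneOn w (Set.mem_Ioi.2 ht0) (Set.mem_Ioi.2 one_pos) ht
  simp only [one_smul, Real.one_rpow, mul_one, Real.rpow_neg ht0.le] at this
  rw [← div_eq_mul_inv, div_le_iff₀ (by positivity)] at this
  linarith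

/-- Since `t d/dt F(tw) = G(tw)`, comparing `G(tw)` with `t ^ (p+2) G(w)` shows that `F(tw) - t ^
(p+2) G(w) / (p+2)` decreases on `(0, 1]` and increases on `[1, ∞)`. The claim is that its minimum
is at `t = 1`. -/
lemma F_smul_ge {t : ℝ} (ht0 : 0 < t) (w : R4) :
    (t ^ (p + 2) - 1) / (p + 2) * G F w ≤ F (t • w) - F w := by
  have hp : 0 < p + 2 := by linarith [hF.p_pos]
  set φ : ℝ → ℝ := fun t => F (t • w) - t ^ (p + 2) / (p + 2) * G F w with hφ
  have hd : ∀ t : ℝ, 0 < t → HasDerivAt φ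
      (fderiv ℝ F (t • w) w - t ^ (p + 1) * G F w) t := by
    intro t ht
    have h1 : HasDerivAt (fun t : ℝ => t • w) w t := by
      simpa using (hasDerivAt_id t).smul_const w
    have h2 := (hF.differentiable (t • w)).hasFDerivAt.comp_hasDerivAt t h1
    have h3 := ((Real.hasDerivAt_rpow_const (x := t) (p := p + 2)
      (Or.inl ht.ne')).div_const (p + 2)).mul_const (G F w)
    refine (h2.sub h3).congr_deriv ?_
    rw [show p + 2 - 1 = p + 1 by ring]
    field_simp
  have hG : ∀ t : ℝ, G F (t • w) = t * fderiv ℝ F (t • w) w := by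
    intro t; simp [G]
  have hr : ∀ t : ℝ, 0 < t → t ^ (p + 2) = t * t ^ (p + 1) := by
    intro t ht
    rw [show p + 2 = p + 1 + 1 by ring, Real.rpow_add_one ht.ne', mul_comm]
  suffices φ 1 ≤ φ t by
    simp only [hφ, one_smul, Real.one_rpow] at this
    rw [sub_div, sub_mul]
    linarith
  rcases le_total t 1 with h1 | h1
  · refine (antitoneOn_of_deriv_nonpos (D := Set.Icc t 1) (convex_Icc _ _)
      (fun s hs => (hd s (ht0.trans_le hs.1)).continuousAt.continuousWithinAt)
      (fun s hs => ?_) (fun s hs => ?_)) (Set.left_mem_Icc.2 h1) (Set.right_mem_Icc.2 h1) h1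
    · rw [interior_Icc] at hs
      exact (hd s (ht0.trans hs.1)).differentiableAt.differentiableWithinAt
    · rw [interior_Icc] at hs
      have hs0 := ht0.trans hs.1
      rw [(hd s hs0).deriv]
      have := hF.G_smul_le hs0 hs.2.le w
      rw [hG, hr s hs0, mul_assoc] at this
      linarith [le_of_mul_le_mul_left this hs0]
  · refine (monotoneOn_of_deriv_nonneg (D := Set.Icc 1 t) (convex_Icc _ _)
      (fun s hs => (hd s (one_pos.trans_le hs.1)).continuousAt.continuousWithinAt)
      (fun s hs => ?_) (fun s hs => ?_)) (Set.left_mem_Icc.2 h1) (Set.right_mem_Icc.2 h1) h1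
    · rw [interior_Icc] at hs
      exact (hd s (one_pos.trans hs.1)).differentiableAt.differentiableWithinAt
    · rw [interior_Icc] at hs
      have hs0 := one_pos.trans hs.1
      rw [(hd s hs0).deriv]
      have := hF.rpow_mul_G_le hs.1.le w
      rw [hG, hr s hs0, mul_assoc] at this
      linarith [le_of_mul_le_mul_left this hs0]

/-- `G - (p + 2) F` is nondecreasing along rays. -/
lemma excess_smul_le {t : ℝ} (ht0 : 0 < t) (ht : t ≤ 1) (w : R4) :
    G F (t • w) - (p + 2) * F (t • w) ≤ G F w - (p + 2) * F w := by
  have hp : 0 < p + 2 := by linarith [hF.p_pos]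
  have h1 := hF.G_smul_le ht0 ht w
  have h2 := mul_le_mul_of_nonneg_left (hF.F_smul_ge ht0 w) hp.le
  have h3 : (p + 2) * ((t ^ (p + 2) - 1) / (p + 2) * G F w) = (t ^ (p + 2) - 1) * G F w := by
    field_simp
  rw [h3] at h2
  linarith

/-- The excess `G - (p+2) F` is monotone along rays and vanishes at the origin, so it is
nonnegative. -/
lemma mul_F_le_G (w : R4) : (p + 2) * F w ≤ G F w := by
  have hc : Continuous fun t : ℝ => G F (t • w) - (p + 2) * F (t • w) := by
    have h1 := hF.quadLip_F.continuous
    have h2 := hF.quadLip_G.continuous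
    fun_prop
  have hlim := (hc.tendsto 0).mono_left (nhdsWithin_le_nhds (s := Set.Ioi 0))
  have : ∀ᶠ t : ℝ in 𝓝[>] 0,
      G F (t • w) - (p + 2) * F (t • w) ≤ G F w - (p + 2) * F w := by
    filter_upwards [Ioo_mem_nhdsGT one_pos] with t ht
    exact hF.excess_smul_le ht.1 ht.2.le w
  have := le_of_tendsto hlim this
  simp only [zero_smul, hF.zero, hF.quadLip_G.zero] at this
  linarith

end Nonlinearity

/-! ### Point evaluation on `H²(ℝ)` -/

/-- The kernel `𝟙_{(x, x+1]}`. -/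
def avgKernel (x z : ℝ) : ℝ := (Set.Ioc x (x + 1)).indicator (fun _ => 1) z

/-- The kernel `(1 - (z - x)) 𝟙_{(x, x+1]}(z)`. -/
def tentKernel (x z : ℝ) : ℝ := (Set.Ioc x (x + 1)).indicator (fun z => 1 - (z - x)) z

lemma memLp_avgKernel (x : ℝ) : MemLp (avgKernel x) 2 volume :=
  memLp_indicator_const 2 measurableSet_Ioc (1 : ℝ) (Or.inr (by simp))

lemma norm_tentKernel_le (x z : ℝ) : ‖tentKernel x z‖ ≤ ‖avgKernel x z‖ := by
  unfold tentKernel avgKernel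
  by_cases h : z ∈ Set.Ioc x (x + 1)
  · rw [Set.indicator_of_mem h, Set.indicator_of_mem h, norm_one, Real.norm_eq_abs, abs_le]
    constructor <;> linarith [h.1, h.2]
  · simp [Set.indicator_of_notMem h]

lemma memLp_tentKernel (x : ℝ) : MemLp (tentKernel x) 2 volume :=
  (memLp_avgKernel x).mono
    ((by fun_prop : Measurable fun z : ℝ => 1 - (z - x)).indicator
      measurableSet_Ioc).aestronglyMeasurable (Eventually.of_forall (norm_tentKernel_le x))

lemma eLpNorm_avgKernel (x : ℝ) : eLpNorm (avgKernel x) 2 volume = 1 := by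
  unfold avgKernel
  rw [eLpNorm_indicator_const measurableSet_Ioc (by norm_num) (by norm_num)]
  simp

lemma inner_toLp_left {k : ℝ → ℝ} (hk : MemLp k 2 volume) (f : L2) :
    inner ℝ (hk.toLp k) f = ∫ z, f z * k z := by
  rw [L2.inner_def]
  refine integral_congr_ae ?_
  filter_upwards [hk.coeFn_toLp] with z hz
  simp [hz]

/-- The functional `(f, g) ↦ ∫_x^{x+1} f - ∫_x^{x+1} (1 - (z - x)) g(z) dz`, which evaluates `f` at
`x` when `g = f'`. -/
def evalFun (x : ℝ) (f g : L2) : ℝ :=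
  inner ℝ ((memLp_avgKernel x).toLp _) f - inner ℝ ((memLp_tentKernel x).toLp _) g

lemma abs_evalFun_le (x : ℝ) (f g : L2) : |evalFun x f g| ≤ ‖f‖ + ‖g‖ := by
  have h1 : ‖(memLp_avgKernel x).toLp _‖ ≤ 1 := by
    rw [Lp.norm_toLp, eLpNorm_avgKernel]; simp
  have h2 : ‖(memLp_tentKernel x).toLp _‖ ≤ 1 := by
    rw [Lp.norm_toLp]
    refine ENNReal.toReal_le_of_le_ofReal zero_le_one ?_
    rw [ENNReal.ofReal_one, ← eLpNorm_avgKernel x]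
    exact eLpNorm_mono (norm_tentKernel_le x)
  refine (abs_sub _ _).trans (add_le_add ?_ ?_)
  · exact (abs_real_inner_le_norm _ _).trans (mul_le_of_le_one_left (norm_nonneg _) h1)
  · exact (abs_real_inner_le_norm _ _).trans (mul_le_of_le_one_left (norm_nonneg _) h2)

lemma evalFun_shift (x y : ℝ) (f g : L2) :
    evalFun x (shift y f) (shift y g) = evalFun (x + y) f g := by
  unfold evalFun
  simp only [inner_toLp_left, integral_shift_mul]
  congr 2 <;> ext z <;> congr 1
  · unfold avgKernel
    simp only [Set.indicator_apply, Set.mem_Ioc]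
    refine if_congr ⟨fun h => ⟨?_, ?_⟩, fun h => ⟨?_, ?_⟩⟩ rfl rfl <;> linarith [h.1, h.2]
  · unfold tentKernel
    simp only [Set.indicator_apply, Set.mem_Ioc]
    refine if_congr ⟨fun h => ⟨?_, ?_⟩, fun h => ⟨?_, ?_⟩⟩ (by ring) rfl <;> linarith [h.1, h.2]

lemma evalFun_eq (x : ℝ) (f g : L2) :
    evalFun x f g = ∫ y in Set.Ioc (0 : ℝ) 1, (f (x + y) - (1 - y) * g (x + y)) := by
  have h1 : Integrable fun z => f z * avgKernel x z :=
    (Lp.memLp f).integrable_mul (memLp_avgKernel x)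
  have h2 : Integrable fun z => g z * tentKernel x z :=
    (Lp.memLp g).integrable_mul (memLp_tentKernel x)
  unfold evalFun
  rw [inner_toLp_left, inner_toLp_left, ← integral_sub h1 h2,
    ← integral_add_left_eq_self _ x, ← integral_indicator measurableSet_Ioc]
  congr 1
  ext y
  unfold avgKernel tentKernel
  simp only [Set.indicator_apply, Set.mem_Ioc]
  by_cases h : 0 < y ∧ y ≤ 1
  · rw [if_pos (by constructor <;> linarith [h.1, h.2]),
      if_pos (by constructor <;> linarith [h.1, h.2]), if_pos h]
    ring
  · rw [if_neg (fun h' => h (by constructor <;> linarith [h'.1, h'.2])),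
      if_neg (fun h' => h (by constructor <;> linarith [h'.1, h'.2])), if_neg h]
    ring

/-- Integrability needed for Fubini. By `|φ f| ≤ φ² + f²` and translation invariance the integral in
`x` is bounded uniformly in `y`, and `y` ranges over a set of finite measure. -/
lemma integrable_prod_mul_translate (f : L2) {φ : ℝ → ℝ} (hφ : Continuous φ)
    (hc : HasCompactSupport φ) :
    Integrable (Function.uncurry fun x y : ℝ => φ x * f (x + y))
      (volume.prod (volume.restrict (Set.Ioc (0 : ℝ) 1))) := by
  have hm : Measurable (Function.uncurry fun x y : ℝ => φ x * f (x + y)) := by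
    have := (Lp.stronglyMeasurable f).measurable
    have h2 := hφ.measurable
    unfold Function.uncurry
    fun_prop
  have hφ2 : MemLp φ 2 volume := hφ.memLp_of_hasCompactSupport hc
  have hfy : ∀ y : ℝ, MemLp (fun x => f (x + y)) 2 volume := fun y =>
    (Lp.memLp f).comp_measurePreserving (measurePreserving_add_right volume y)
  rw [integrable_prod_iff' hm.aestronglyMeasurable]
  refine ⟨Eventually.of_forall fun y => hφ2.integrable_mul (hfy y), ?_⟩
  refine Integrable.of_bound (C := (∫ x, φ x ^ 2) + ∫ x, f x ^ 2)
    hm.norm.aestronglyMeasurable.prod_swap.integral_prod_right' (Eventually.of_forall fun y => ?_)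
  rw [Real.norm_of_nonneg (integral_nonneg fun _ => norm_nonneg _),
    ← integral_add_right_eq_self (fun x => f x ^ 2) y,
    ← integral_add hφ2.integrable_sq (hfy y).integrable_sq]
  refine integral_mono_of_nonneg (Eventually.of_forall fun _ => norm_nonneg _)
    (hφ2.integrable_sq.add (hfy y).integrable_sq) (Eventually.of_forall fun x => ?_)
  simp only [Function.uncurry, norm_mul, Real.norm_eq_abs]
  nlinarith [sq_nonneg (|φ x| - |f (x + y)|), sq_abs (φ x), sq_abs (f (x + y)),
    sq_nonneg (φ x), sq_nonneg (f (x + y))]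

/-- The integral is the convolution of `f` with the reflection of `φ`. It is differentiated on the
smooth factor, and the weak derivative identity moves the derivative back to `f`. -/
lemma IsWeakDeriv.hasDerivAt_integral_translate {f g : L2} (h : IsWeakDeriv f g) {φ : ℝ → ℝ}
    (hφ : ContDiff ℝ (⊤ : ℕ∞) φ) (hc : HasCompactSupport φ) (y : ℝ) :
    HasDerivAt (fun y => ∫ x, f x * φ (x - y)) (∫ x, g x * φ (x - y)) y := by
  have hc' : HasCompactSupport (fun x => φ (-x)) := hc.comp_homeomorph (Homeomorph.neg ℝ)
  have hφ' : ContDiff ℝ 1 (fun x => φ (-x)) := (hφ.of_le (by simp)).comp contDiff_neg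
  have hf : LocallyIntegrable f volume := (Lp.memLp f).locallyIntegrable (by norm_num)
  have := hc'.hasDerivAt_convolution_right (ContinuousLinearMap.mul ℝ ℝ) hf hφ' y
  have h2 := h (fun x => φ (x - y)) (hφ.comp (contDiff_id.sub contDiff_const))
    (hc.comp_homeomorph (Homeomorph.subRight y))
  simp only [deriv_comp_sub_const] at h2
  rw [← neg_eq_iff_eq_neg] at h2
  rw [← h2, ← integral_neg]
  have he : (fun y => ∫ x, f x * φ (x - y))
      = convolution f (fun x => φ (-x)) (ContinuousLinearMap.mul ℝ ℝ) volume := by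
    ext y
    simp [convolution_def]
  rw [he]
  refine this.congr_deriv ?_
  simp only [convolution_def, ContinuousLinearMap.mul_apply', deriv_comp_neg, mul_neg, neg_sub]

lemma continuous_integral_translate (f : L2) {φ : ℝ → ℝ}
    (hφ : Continuous φ) (hc : HasCompactSupport φ) :
    Continuous (fun y => ∫ x, f x * φ (x - y)) := by
  have hc' : HasCompactSupport (fun x => φ (-x)) := hc.comp_homeomorph (Homeomorph.neg ℝ)
  have hf : LocallyIntegrable f volume := (Lp.memLp f).locallyIntegrable (by norm_num)
  have := hc'.continuous_convolution_right (ContinuousLinearMap.mul ℝ ℝ) hf (by fun_prop)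
  convert this using 1
  ext y
  simp [convolution_def]

/-- A function in `H¹` agrees almost everywhere with its point evaluations. -/
lemma IsWeakDeriv.ae_eq_evalFun {f g : L2} (h : IsWeakDeriv f g) :
    ∀ᵐ x, f x = evalFun x f g := by
  have hf : LocallyIntegrable f volume := (Lp.memLp f).locallyIntegrable (by norm_num)
  have hmeas : AEStronglyMeasurable (fun x => evalFun x f g) volume := by
    simp only [evalFun_eq]
    have h1 := (Lp.stronglyMeasurable f).measurable
    have h2 := (Lp.stronglyMeasurable g).measurable
    have : Measurable (fun z : ℝ × ℝ => f (z.1 + z.2) - (1 - z.2) * g (z.1 + z.2)) := by fun_prop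
    exact (this.aestronglyMeasurable (μ := volume.prod
      (volume.restrict (Set.Ioc (0 : ℝ) 1)))).integral_prod_right'
  have hloc : LocallyIntegrable (fun x => evalFun x f g) volume := by
    refine LocallyIntegrable.mono (g := fun x => evalFun x f g) (f := fun _ => ‖f‖ + ‖g‖)
      (continuous_const.locallyIntegrable) hmeas (Eventually.of_forall fun x => ?_)
    exact (abs_evalFun_le x f g).trans (le_abs_self _)
  refine ae_eq_of_integral_contDiff_smul_eq hf hloc fun φ hφ hc => ?_
  have hφc := hφ.continuous
  have hif := integrable_prod_mul_translate f hφc hc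
  have hig := integrable_prod_mul_translate g hφc hc
  have hig' : Integrable (Function.uncurry fun x y : ℝ => (1 - y) * (φ x * g (x + y)))
      (volume.prod (volume.restrict (Set.Ioc (0 : ℝ) 1))) := by
    refine Integrable.mono hig ?_ ?_
    · have : Measurable fun z : ℝ × ℝ => 1 - z.2 := by fun_prop
      exact this.aestronglyMeasurable.mul hig.aestronglyMeasurable
    · have : ∀ᵐ z : ℝ × ℝ ∂(volume.prod (volume.restrict (Set.Ioc (0 : ℝ) 1))),
          z.2 ∈ Set.Ioc (0 : ℝ) 1 :=
        Measure.quasiMeasurePreserving_snd.ae (ae_restrict_mem measurableSet_Ioc)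
      filter_upwards [this] with z hz
      simp only [Function.uncurry, norm_mul]
      refine mul_le_of_le_one_left (by positivity) ?_
      rw [Real.norm_eq_abs, abs_le]
      constructor <;> linarith [hz.1, hz.2]
  have hA : ∀ (u : L2) (y : ℝ), ∫ x, φ x * u (x + y) = ∫ x, u x * φ (x - y) := by
    intro u y
    rw [← integral_add_right_eq_self (fun x => u x * φ (x - y)) y]
    simp [mul_comm]
  set A : ℝ → ℝ := fun y => ∫ x, f x * φ (x - y) with hAdef
  set A' : ℝ → ℝ := fun y => ∫ x, g x * φ (x - y) with hA'def
  have hAd : ∀ y, HasDerivAt A (A' y) y := fun y => h.hasDerivAt_integral_translate hφ hc y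
  have hA'c : Continuous A' := continuous_integral_translate g hφc hc
  have hAc : Continuous A := continuous_integral_translate f hφc hc
  -- Fubini reduces the test against `φ` to an integral of the classically differentiable function
  -- `A`.
  have key : ∫ x, φ x * evalFun x f g = ∫ y in Set.Ioc (0 : ℝ) 1, (A y - (1 - y) * A' y) := by
    calc ∫ x, φ x * evalFun x f g
        = ∫ x, ∫ y in Set.Ioc (0 : ℝ) 1, (φ x * f (x + y) - (1 - y) * (φ x * g (x + y))) := by
          congr 1
          ext x
          rw [evalFun_eq, ← integral_const_mul]
          congr 1
          ext y
          ring
      _ = ∫ y in Set.Ioc (0 : ℝ) 1, ∫ x, (φ x * f (x + y) - (1 - y) * (φ x * g (x + y))) :=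
          integral_integral_swap (hif.sub hig')
      _ = _ := by
          refine integral_congr_ae ?_
          filter_upwards [hif.prod_left_ae, hig'.prod_left_ae] with y h1 h2
          simp only [Function.uncurry_apply_pair] at h1 h2
          rw [integral_sub h1 h2, integral_const_mul, hA, hA]
  have hFTC : ∫ y in (0 : ℝ)..1, (A y - (1 - y) * A' y) = A 0 := by
    -- The weight `1 - y` vanishes at the upper endpoint, so only `A 0`, the test of `f` itself,
    -- survives.
    have hd : ∀ y : ℝ, HasDerivAt (fun y => -((1 - y) * A y)) (A y - (1 - y) * A' y) y := by
      intro y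
      have := (((hasDerivAt_id y).const_sub 1).mul (hAd y)).neg
      refine this.congr_deriv ?_
      simp only [id_eq]
      ring
    rw [intervalIntegral.integral_eq_sub_of_hasDerivAt (fun y _ => hd y)
      (Continuous.intervalIntegrable (by fun_prop) _ _)]
    simp
  simp only [smul_eq_mul]
  rw [key, ← intervalIntegral.integral_of_le zero_le_one, hFTC, hAdef]
  simp [mul_comm]

/-- The `i`-th weak derivative as a continuous linear map. -/
def derivL (i : Fin 3) : H2 →L[ℝ] L2 :=
  (PiLp.proj 2 (fun _ : Fin 3 => L2) i) ∘L H2.subtypeL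

lemma norm_sq_H2 (u : H2) : ‖u‖ ^ 2 = ‖D u 0‖ ^ 2 + ‖D u 1‖ ^ 2 + ‖D u 2‖ ^ 2 := by
  have := PiLp.norm_sq_eq_of_L2 (fun _ : Fin 3 => L2) (u : PiLp 2 fun _ : Fin 3 => L2)
  rw [Fin.sum_univ_three] at this
  exact this

lemma norm_D_le (u : H2) (i : Fin 3) : ‖D u i‖ ≤ ‖u‖ :=
  PiLp.norm_apply_le (u : PiLp 2 fun _ : Fin 3 => L2) i

/-- The evaluation at `x` of the `i`-th derivative of an `H²` function, `i = 0, 1`. -/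
def evalL (x : ℝ) (i : Fin 2) : H2 →L[ℝ] ℝ :=
  (innerSL ℝ ((memLp_avgKernel x).toLp _)) ∘L derivL i.castSucc
    - (innerSL ℝ ((memLp_tentKernel x).toLp _)) ∘L derivL i.succ

lemma evalL_apply (x : ℝ) (i : Fin 2) (u : H2) :
    evalL x i u = evalFun x (D u i.castSucc) (D u i.succ) := rfl

lemma abs_evalL_le (x : ℝ) (i : Fin 2) (u : H2) : |evalL x i u| ≤ 2 * ‖u‖ := by
  rw [evalL_apply]
  refine (abs_evalFun_le _ _ _).trans ?_
  linarith [norm_D_le u i.castSucc, norm_D_le u i.succ]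

lemma ae_eq_evalL (i : Fin 2) (u : H2) : ∀ᵐ x, D u i.castSucc x = evalL x i u := by
  have : IsWeakDeriv (D u i.castSucc) (D u i.succ) := by
    fin_cases i
    · exact u.2.1
    · exact u.2.2
  exact this.ae_eq_evalFun

/-- The value at `x` of `(ψ, ψ', v, v')`, as a continuous linear map. -/
def jetL (x : ℝ) : X →L[ℝ] R4 :=
  (EuclideanSpace.equiv (Fin 4) ℝ).symm.toContinuousLinearMap ∘L
    ContinuousLinearMap.pi ![evalL x 0 ∘L ContinuousLinearMap.fst ℝ H2 H2,
      evalL x 1 ∘L ContinuousLinearMap.fst ℝ H2 H2,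
      evalL x 0 ∘L ContinuousLinearMap.snd ℝ H2 H2,
      evalL x 1 ∘L ContinuousLinearMap.snd ℝ H2 H2]

lemma jetL_apply (x : ℝ) (Ψ : X) :
    jetL x Ψ = !₂[evalL x 0 Ψ.1, evalL x 1 Ψ.1, evalL x 0 Ψ.2, evalL x 1 Ψ.2] := by
  ext i
  fin_cases i <;> rfl

lemma jet_ae_eq (Ψ : X) : ∀ᵐ x, jet Ψ x = jetL x Ψ := by
  filter_upwards [ae_eq_evalL 0 Ψ.1, ae_eq_evalL 1 Ψ.1, ae_eq_evalL 0 Ψ.2, ae_eq_evalL 1 Ψ.2]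
    with x h1 h2 h3 h4
  rw [jetL_apply, ← h1, ← h2, ← h3, ← h4]
  rfl

lemma norm_sq_R4 (w : R4) : ‖w‖ ^ 2 = w 0 ^ 2 + w 1 ^ 2 + w 2 ^ 2 + w 3 ^ 2 := by
  rw [EuclideanSpace.real_norm_sq_eq, Fin.sum_univ_four]

/-- Four components, each at most `2 ‖Ψ‖`, give the Euclidean bound `4 ‖Ψ‖`. This is the embedding
of `H²` into bounded `C¹` functions. -/
lemma norm_jetL_le (x : ℝ) (Ψ : X) : ‖jetL x Ψ‖ ≤ 4 * ‖Ψ‖ := by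
  have hn := norm_nonneg Ψ
  have key : ∀ (i : Fin 2) (u : H2), ‖u‖ ≤ ‖Ψ‖ → evalL x i u ^ 2 ≤ (2 * ‖Ψ‖) ^ 2 := by
    intro i u hu
    rw [sq_le_sq, abs_of_nonneg (by positivity : 0 ≤ 2 * ‖Ψ‖)]
    exact (abs_evalL_le x i u).trans (by linarith)
  refine le_of_sq_le_sq ?_ (by positivity)
  rw [norm_sq_R4, jetL_apply]
  simp only [Matrix.cons_val_zero, Matrix.cons_val_one, Matrix.cons_val]
  have h1 := norm_fst_le Ψ
  have h2 := norm_snd_le Ψ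
  linarith [key 0 Ψ.1 h1, key 1 Ψ.1 h1, key 0 Ψ.2 h2, key 1 Ψ.2 h2]

lemma jetL_translate (x y : ℝ) (Ψ : X) : jetL x (translate y Ψ) = jetL (x + y) Ψ := by
  have h : ∀ (i : Fin 2) (u : H2), evalL x i (H2translate y u) = evalL (x + y) i u :=
    fun i u => evalFun_shift x y (D u i.castSucc) (D u i.succ)
  rw [jetL_apply, jetL_apply]
  simp only [translate, h]

/-! ### Weak sequential compactness of bounded sets -/

/-- In a separable Hilbert space bounded sequences have weakly convergent subsequences. -/
lemma exists_weak_limit {V : Type*} [NormedAddCommGroup V] [InnerProductSpace ℝ V]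
    [CompleteSpace V] [TopologicalSpace.SeparableSpace V] {u : ℕ → V} {R : ℝ}
    (hu : ∀ n, ‖u n‖ ≤ R) :
    ∃ (v : V) (φ : ℕ → ℕ), StrictMono φ ∧
      ∀ ℓ : V →L[ℝ] ℝ, Tendsto (fun k => ℓ (u (φ k))) atTop (𝓝 (ℓ v)) := by
  -- Sequential Banach–Alaoglu in the dual, carried back to `V` by the Riesz isomorphism.
  have hc := WeakDual.isSeqCompact_closedBall ℝ V 0 R
  obtain ⟨f, -, φ, hφ, hlim⟩ := hc
    (x := fun n => StrongDual.toWeakDual (InnerProductSpace.toDual ℝ V (u n))) (by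
      intro n
      simpa using hu n)
  refine ⟨(InnerProductSpace.toDual ℝ V).symm (WeakDual.toStrongDual f), φ, hφ, fun ℓ => ?_⟩
  have h1 := (WeakDual.eval_continuous ((InnerProductSpace.toDual ℝ V).symm ℓ)).tendsto f
  have h2 := h1.comp hlim
  have e1 : ∀ w : V, inner ℝ w ((InnerProductSpace.toDual ℝ V).symm ℓ) = ℓ w := by
    intro w
    rw [real_inner_comm, InnerProductSpace.toDual_symm_apply]
  have e2 : f ((InnerProductSpace.toDual ℝ V).symm ℓ)
      = ℓ ((InnerProductSpace.toDual ℝ V).symm (WeakDual.toStrongDual f)) := by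
    rw [← e1, InnerProductSpace.toDual_symm_apply]
    rfl
  rw [e2] at h2
  refine h2.congr fun k => ?_
  exact e1 (u (φ k))

/-- Each test function imposes one closed condition, an equality of continuous linear functionals.
This yields completeness of `H²`, on which weak compactness relies. -/
lemma isClosed_isWeakDeriv : IsClosed {p : L2 × L2 | IsWeakDeriv p.1 p.2} := by
  have : {p : L2 × L2 | IsWeakDeriv p.1 p.2} = ⋂ (φ : ℝ → ℝ) (hφ : ContDiff ℝ (⊤ : ℕ∞) φ)
      (hc : HasCompactSupport φ),
      {p : L2 × L2 | inner ℝ (((hφ.continuous_deriv (by simp)).memLp_of_hasCompactSupport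
        (p := 2) (μ := volume) hc.deriv).toLp _) p.1
        = -inner ℝ ((hφ.continuous.memLp_of_hasCompactSupport (p := 2) (μ := volume) hc).toLp _)
          p.2} := by
    ext p
    simp only [Set.mem_iInter, Set.mem_ofPred_eq, inner_toLp_left]
    rfl
  rw [this]
  refine isClosed_iInter fun φ => isClosed_iInter fun hφ => isClosed_iInter fun hc =>
    isClosed_eq ?_ ?_ <;> fun_prop

instance : CompleteSpace H2 := by
  have h : ∀ i : Fin 3, Continuous fun U : PiLp 2 fun _ : Fin 3 => L2 => U i :=
    fun i => (PiLp.proj 2 (𝕜 := ℝ) (fun _ : Fin 3 => L2) i).continuous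
  have : IsClosed (H2 : Set (PiLp 2 fun _ : Fin 3 => L2)) :=
    (isClosed_isWeakDeriv.preimage ((h 0).prodMk (h 1))).inter
      (isClosed_isWeakDeriv.preimage ((h 1).prodMk (h 2)))
  exact this.completeSpace_coe

instance : TopologicalSpace.SeparableSpace H2 := by
  have : Fact ((2 : ENNReal) ≠ ⊤) := ⟨by norm_num⟩
  have : SecondCountableTopology L2 := inferInstance
  have : SecondCountableTopology (PiLp 2 fun _ : Fin 3 => L2) :=
    (PiLp.homeomorph 2 fun _ : Fin 3 => L2).secondCountableTopology
  have : SecondCountableTopology H2 :=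
    TopologicalSpace.Subtype.secondCountableTopology _
  infer_instance

/-- Bounded sequences in the energy space have weakly convergent subsequences. -/
lemma exists_weak_limit_X {Ψ : ℕ → X} {R : ℝ} (hΨ : ∀ n, ‖Ψ n‖ ≤ R) :
    ∃ (Ψ₀ : X) (φ : ℕ → ℕ), StrictMono φ ∧
      ∀ ℓ : X →L[ℝ] ℝ, Tendsto (fun k => ℓ (Ψ (φ k))) atTop (𝓝 (ℓ Ψ₀)) := by
  obtain ⟨u, φ, hφ, hu⟩ := exists_weak_limit fun n => (norm_fst_le (Ψ n)).trans (hΨ n)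
  obtain ⟨v, χ, hχ, hv⟩ := exists_weak_limit fun n => (norm_snd_le (Ψ (φ n))).trans (hΨ (φ n))
  refine ⟨(u, v), φ ∘ χ, hφ.comp hχ, fun ℓ => ?_⟩
  have h1 := (hu (ℓ ∘L ContinuousLinearMap.inl ℝ H2 H2)).comp hχ.tendsto_atTop
  have h2 := hv (ℓ ∘L ContinuousLinearMap.inr ℝ H2 H2)
  have key : ∀ Φ : X, ℓ Φ = (ℓ ∘L ContinuousLinearMap.inl ℝ H2 H2) Φ.1
      + (ℓ ∘L ContinuousLinearMap.inr ℝ H2 H2) Φ.2 := by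
    intro Φ
    simp [← map_add]
  rw [key (u, v)]
  refine (h1.add h2).congr fun k => ?_
  exact (key _).symm

lemma tendsto_jetL {Ψ : ℕ → X} {Ψ₀ : X}
    (h : ∀ ℓ : X →L[ℝ] ℝ, Tendsto (fun k => ℓ (Ψ k)) atTop (𝓝 (ℓ Ψ₀))) (x : ℝ) :
    Tendsto (fun k => jetL x (Ψ k)) atTop (𝓝 (jetL x Ψ₀)) := by
  let e := EuclideanSpace.equiv (Fin 4) ℝ
  have : Tendsto (fun k => e (jetL x (Ψ k))) atTop (𝓝 (e (jetL x Ψ₀))) := by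
    rw [tendsto_pi_nhds]
    intro i
    exact h (EuclideanSpace.proj i ∘L jetL x)
  simpa [Function.comp_def] using (e.symm.continuous.tendsto _).comp this

/-! ### Integral functionals of the jet -/

lemma integral_sq_L2 (f : L2) : ∫ x, f x ^ 2 = ‖f‖ ^ 2 := by
  rw [← real_inner_self_eq_norm_sq, L2.inner_def]
  simp [pow_two]

lemma integral_mul_L2 (f g : L2) : ∫ x, f x * g x = inner ℝ f g := by
  rw [L2.inner_def]
  simp [mul_comm]

lemma integrable_sq_L2 (f : L2) : Integrable (fun x => f x ^ 2) := (Lp.memLp f).integrable_sq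

lemma integrable_mul_L2 (f g : L2) : Integrable (fun x => f x * g x) :=
  (Lp.memLp f).integrable_mul (Lp.memLp g)

lemma integral_jet (f : R4 → ℝ) (Ψ : X) : ∫ x, f (jet Ψ x) = ∫ x, f (jetL x Ψ) :=
  integral_congr_ae ((jet_ae_eq Ψ).mono fun x hx => by simp only [hx])

lemma measurable_jet (Ψ : X) : Measurable (jet Ψ) := by
  have h : ∀ f : L2, Measurable f := fun f => (Lp.stronglyMeasurable f).measurable
  refine (MeasurableEquiv.toLp 2 (Fin 4 → ℝ)).measurable.comp (measurable_pi_lambda _ fun i => ?_)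
  fin_cases i
  · exact h _
  · exact h _
  · exact h _
  · exact h _

lemma aestronglyMeasurable_jetL (Ψ : X) : AEStronglyMeasurable (fun x => jetL x Ψ) volume :=
  (measurable_jet Ψ).aestronglyMeasurable.congr (jet_ae_eq Ψ)

lemma norm_sq_jet (Ψ : X) (x : ℝ) : ‖jet Ψ x‖ ^ 2
    = D Ψ.1 0 x ^ 2 + D Ψ.1 1 x ^ 2 + D Ψ.2 0 x ^ 2 + D Ψ.2 1 x ^ 2 := by
  rw [norm_sq_R4]
  rfl

lemma integrable_norm_sq_jetL (Ψ : X) : Integrable (fun x => ‖jetL x Ψ‖ ^ 2) := by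
  have h : Integrable (fun x => ‖jet Ψ x‖ ^ 2) := by
    simp only [norm_sq_jet]
    exact (((integrable_sq_L2 _).add (integrable_sq_L2 _)).add (integrable_sq_L2 _)).add
      (integrable_sq_L2 _)
  exact h.congr ((jet_ae_eq Ψ).mono fun x hx => by simp only [hx])

lemma integral_norm_sq_jetL_le (Ψ : X) : ∫ x, ‖jetL x Ψ‖ ^ 2 ≤ 2 * ‖Ψ‖ ^ 2 := by
  have h : ∫ x, ‖jetL x Ψ‖ ^ 2
      = ‖D Ψ.1 0‖ ^ 2 + ‖D Ψ.1 1‖ ^ 2 + ‖D Ψ.2 0‖ ^ 2 + ‖D Ψ.2 1‖ ^ 2 := by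
    rw [← integral_jet (fun w => ‖w‖ ^ 2)]
    simp only [norm_sq_jet]
    have h0 := integrable_sq_L2 (D Ψ.1 0)
    have h1 := integrable_sq_L2 (D Ψ.1 1)
    have h2 := integrable_sq_L2 (D Ψ.2 0)
    have h3 := integrable_sq_L2 (D Ψ.2 1)
    rw [integral_add ((h0.fun_add h1).fun_add h2) h3, integral_add (h0.fun_add h1) h2,
      integral_add h0 h1]
    simp only [integral_sq_L2]
  have h1 := norm_sq_H2 Ψ.1
  have h2 := norm_sq_H2 Ψ.2
  have h3 : ‖Ψ.1‖ ^ 2 ≤ ‖Ψ‖ ^ 2 := by gcongr; exact norm_fst_le Ψ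
  have h4 : ‖Ψ.2‖ ^ 2 ≤ ‖Ψ‖ ^ 2 := by gcongr; exact norm_snd_le Ψ
  rw [h]
  nlinarith [sq_nonneg ‖D Ψ.1 2‖, sq_nonneg ‖D Ψ.2 2‖]

lemma memLp_norm_jetL (Ψ : X) : MemLp (fun x => ‖jetL x Ψ‖) 2 volume :=
  (memLp_two_iff_integrable_sq (aestronglyMeasurable_jetL Ψ).norm).2 (integrable_norm_sq_jetL Ψ)

lemma integrable_norm_mul_norm_jetL (Ψ Φ : X) : Integrable fun x => ‖jetL x Ψ‖ * ‖jetL x Φ‖ :=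
  (memLp_norm_jetL Ψ).integrable_mul (memLp_norm_jetL Φ)

/-- Cauchy–Schwarz in `L²`. The factor `2` appears because `X` carries the maximum norm of its two
components. -/
lemma integral_norm_mul_norm_jetL_le (Ψ Φ : X) :
    ∫ x, ‖jetL x Ψ‖ * ‖jetL x Φ‖ ≤ 2 * (‖Ψ‖ * ‖Φ‖) := by
  have hn : ∀ Ψ : X, ‖(memLp_norm_jetL Ψ).toLp _‖ ^ 2 ≤ 2 * ‖Ψ‖ ^ 2 := by
    intro Ψ
    rw [← integral_sq_L2]
    refine le_trans (le_of_eq ?_) (integral_norm_sq_jetL_le Ψ)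
    exact integral_congr_ae ((memLp_norm_jetL Ψ).coeFn_toLp.mono fun x hx => by simp only [hx])
  have hi : ∫ x, ‖jetL x Ψ‖ * ‖jetL x Φ‖
      = inner ℝ ((memLp_norm_jetL Ψ).toLp _) ((memLp_norm_jetL Φ).toLp _) := by
    rw [inner_toLp_left]
    refine integral_congr_ae ((memLp_norm_jetL Φ).coeFn_toLp.mono fun x hx => ?_)
    simp only [hx, mul_comm]
  rw [hi]
  refine (real_inner_le_norm _ _).trans (le_of_sq_le_sq ?_ (by positivity))
  rw [mul_pow]
  calc _ ≤ (2 * ‖Ψ‖ ^ 2) * (2 * ‖Φ‖ ^ 2) :=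
        mul_le_mul (hn Ψ) (hn Φ) (by positivity) (by positivity)
    _ = _ := by ring

/-- The functional `Ψ ↦ ∫ f(ψ, ψ', v, v')`. -/
def jetIntegral (f : R4 → ℝ) (Ψ : X) : ℝ := ∫ x, f (jetL x Ψ)

lemma K_eq_jetIntegral (F : R4 → ℝ) (Ψ : X) : K F Ψ = jetIntegral F Ψ := integral_jet F Ψ

lemma N_eq_jetIntegral (F : R4 → ℝ) (Ψ : X) : N F Ψ = jetIntegral (G F) Ψ := integral_jet (G F) Ψ

lemma jetIntegral_translate {f : R4 → ℝ} (y : ℝ) (Ψ : X) :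
    jetIntegral f (translate y Ψ) = jetIntegral f Ψ := by
  unfold jetIntegral
  simp only [jetL_translate]
  exact integral_add_right_eq_self (fun x => f (jetL x Ψ)) y

namespace QuadLip

variable {B : ℝ → ℝ} {f : R4 → ℝ}

lemma aestronglyMeasurable (h : QuadLip B f) (Ψ : X) :
    AEStronglyMeasurable (fun x => f (jetL x Ψ)) volume :=
  h.continuous.comp_aestronglyMeasurable (aestronglyMeasurable_jetL Ψ)

lemma integrable (h : QuadLip B f) (Ψ : X) : Integrable (fun x => f (jetL x Ψ)) := by
  refine Integrable.mono' ((integrable_norm_sq_jetL Ψ).const_mul (B (4 * ‖Ψ‖)))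
    (h.aestronglyMeasurable Ψ) (Eventually.of_forall fun x => ?_)
  exact h.abs_le (norm_jetL_le x Ψ)

lemma abs_jetIntegral_sub_le (h : QuadLip B f) {R : ℝ} (hB : 0 ≤ B (4 * R)) {Ψ Φ : X}
    (hΨ : ‖Ψ‖ ≤ R) (hΦ : ‖Φ‖ ≤ R) :
    |jetIntegral f Ψ - jetIntegral f Φ| ≤ B (4 * R) * (4 * R) * ‖Ψ - Φ‖ := by
  unfold jetIntegral
  rw [← integral_sub (h.integrable Ψ) (h.integrable Φ)]
  have h1 := integrable_norm_mul_norm_jetL Ψ (Ψ - Φ)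
  have h2 := integrable_norm_mul_norm_jetL Φ (Ψ - Φ)
  have hb : ∫ x, B (4 * R) * (‖jetL x Ψ‖ * ‖jetL x (Ψ - Φ)‖ + ‖jetL x Φ‖ * ‖jetL x (Ψ - Φ)‖)
      ≤ B (4 * R) * (4 * R) * ‖Ψ - Φ‖ := by
    rw [integral_const_mul, integral_add h1 h2, mul_assoc]
    refine mul_le_mul_of_nonneg_left ?_ hB
    have h3 := integral_norm_mul_norm_jetL_le Ψ (Ψ - Φ)
    have h4 := integral_norm_mul_norm_jetL_le Φ (Ψ - Φ)
    nlinarith [norm_nonneg (Ψ - Φ)]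
  rw [← Real.norm_eq_abs]
  refine le_trans (norm_integral_le_of_norm_le ((h1.fun_add h2).const_mul (B (4 * R)))
    (Eventually.of_forall fun x => ?_)) hb
  have := h.lip (4 * R) (jetL x Ψ) (jetL x Φ) ((norm_jetL_le x Ψ).trans (by linarith))
    ((norm_jetL_le x Φ).trans (by linarith))
  rw [← map_sub, add_mul] at this
  exact this

lemma continuous_jetIntegral (h : QuadLip B f) (hB : ∀ M, 0 ≤ M → 0 ≤ B M) :
    Continuous (jetIntegral f) := by
  rw [continuous_iff_continuousAt]
  intro Ψ
  rw [ContinuousAt, tendsto_iff_norm_sub_tendsto_zero]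
  have hlim : Tendsto (fun Φ : X => B (4 * (‖Ψ‖ + 1)) * (4 * (‖Ψ‖ + 1)) * ‖Φ - Ψ‖) (𝓝 Ψ)
      (𝓝 0) := by
    have : Continuous (fun Φ : X => B (4 * (‖Ψ‖ + 1)) * (4 * (‖Ψ‖ + 1)) * ‖Φ - Ψ‖) := by fun_prop
    simpa using this.tendsto Ψ
  refine squeeze_zero' (Eventually.of_forall fun _ => norm_nonneg _) ?_ hlim
  have : ∀ᶠ Φ : X in 𝓝 Ψ, ‖Φ‖ < ‖Ψ‖ + 1 :=
    continuous_norm.continuousAt.eventually_lt continuousAt_const (by simp)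
  filter_upwards [this] with Φ hΦ
  exact h.abs_jetIntegral_sub_le (hB _ (by positivity)) hΦ.le (by simp)

end QuadLip

/-! ### Splitting of the integral functionals -/

/-- If `Φₙ` is bounded and its jets tend to zero pointwise, then the products of the jets with a
fixed one tend to zero in mean. -/
lemma tendsto_integral_norm_mul_norm_jetL {Φ : ℕ → X} {R : ℝ} (hΦ : ∀ n, ‖Φ n‖ ≤ R)
    (h0 : ∀ x, Tendsto (fun n => jetL x (Φ n)) atTop (𝓝 0)) (Ψ : X) :
    Tendsto (fun n => ∫ x, ‖jetL x (Φ n)‖ * ‖jetL x Ψ‖) atTop (𝓝 0) := by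
  have hR : 0 ≤ R := (norm_nonneg _).trans (hΦ 0)
  refine Metric.tendsto_atTop.2 fun δ hδ => ?_
  -- Chosen so that `ε ∫ ‖jetL x (Φ n)‖²`, which is at most `2 ε R²`, takes up no more than half of
  -- `δ`.
  set ε : ℝ := δ / (4 * (R ^ 2 + 1)) with hε
  have hε0 : 0 < ε := by positivity
  have hεR : ε * (2 * R ^ 2) ≤ δ / 2 := by
    rw [hε, div_mul_eq_mul_div, div_le_iff₀ (by positivity)]
    nlinarith
  -- Subtracting `ε ‖jetL x (Φ n)‖²` leaves, by Young's inequality, a part dominated by `‖jetL x Ψ‖²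
  -- / (4ε)`. Dominated convergence applies to it although the jets of `Φ n` converge only
  -- pointwise.
  let g : ℕ → ℝ → ℝ := fun n x => max (‖jetL x (Φ n)‖ * ‖jetL x Ψ‖ - ε * ‖jetL x (Φ n)‖ ^ 2) 0
  have hgm : ∀ n, AEStronglyMeasurable (g n) volume := fun n =>
    (((aestronglyMeasurable_jetL (Φ n)).norm.mul (aestronglyMeasurable_jetL Ψ).norm).sub
      (((aestronglyMeasurable_jetL (Φ n)).norm.pow 2).const_mul ε)).sup
      aestronglyMeasurable_const
  have hbi : Integrable (fun x => (4 * ε)⁻¹ * ‖jetL x Ψ‖ ^ 2) :=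
    (integrable_norm_sq_jetL Ψ).const_mul _
  have hgb : ∀ n x, ‖g n x‖ ≤ (4 * ε)⁻¹ * ‖jetL x Ψ‖ ^ 2 := by
    intro n x
    rw [Real.norm_of_nonneg (le_max_right _ _)]
    refine max_le ?_ (by positivity)
    rw [inv_mul_eq_div, le_div_iff₀ (by positivity)]
    nlinarith [sq_nonneg (2 * ε * ‖jetL x (Φ n)‖ - ‖jetL x Ψ‖)]
  have hgl : Tendsto (fun n => ∫ x, g n x) atTop (𝓝 0) := by
    have := tendsto_integral_of_dominated_convergence (F := g) (f := fun _ => 0) (μ := volume) _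
      hgm hbi (fun n => Eventually.of_forall (hgb n)) (Eventually.of_forall fun x => ?_)
    · simpa using this
    · have hn : Tendsto (fun n => ‖jetL x (Φ n)‖) atTop (𝓝 0) := by
        simpa using (h0 x).norm
      have := ((hn.mul_const ‖jetL x Ψ‖).sub ((hn.pow 2).const_mul ε)).max
        (tendsto_const_nhds (x := (0 : ℝ)))
      simpa using this
  obtain ⟨n₀, hn₀⟩ := (Metric.tendsto_atTop.1 hgl) (δ / 2) (by positivity)
  refine ⟨n₀, fun n hn => ?_⟩
  have h1 := hn₀ n hn
  rw [Real.dist_eq, sub_zero] at h1 ⊢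
  rw [abs_of_nonneg (integral_nonneg fun x => by positivity)]
  have h2 : ∫ x, ‖jetL x (Φ n)‖ * ‖jetL x Ψ‖ ≤ ∫ x, (g n x + ε * ‖jetL x (Φ n)‖ ^ 2) := by
    refine integral_mono (integrable_norm_mul_norm_jetL _ _)
      ((Integrable.mono' hbi (hgm n) (Eventually.of_forall (hgb n))).add
        ((integrable_norm_sq_jetL (Φ n)).const_mul ε)) fun x => ?_
    have := le_max_left (‖jetL x (Φ n)‖ * ‖jetL x Ψ‖ - ε * ‖jetL x (Φ n)‖ ^ 2) 0
    simp only [g]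
    linarith
  rw [integral_add (Integrable.mono' hbi (hgm n) (Eventually.of_forall (hgb n)))
    ((integrable_norm_sq_jetL (Φ n)).const_mul ε), integral_const_mul] at h2
  have h3 : ε * ∫ x, ‖jetL x (Φ n)‖ ^ 2 ≤ δ / 2 := by
    refine le_trans (mul_le_mul_of_nonneg_left ?_ hε0.le) hεR
    refine (integral_norm_sq_jetL_le (Φ n)).trans ?_
    have := norm_nonneg (Φ n)
    have := hΦ n
    gcongr
  linarith [(abs_lt.1 h1).2]

/-- Splitting of the integral functional along weakly convergent sequences. -/
lemma QuadLip.tendsto_jetIntegral_split {B : ℝ → ℝ} {f : R4 → ℝ} (h : QuadLip B f)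
    (hB : ∀ M, 0 ≤ M → 0 ≤ B M) {Φ : ℕ → X} {R : ℝ} (hΦ : ∀ n, ‖Φ n‖ ≤ R)
    (h0 : ∀ x, Tendsto (fun n => jetL x (Φ n)) atTop (𝓝 0)) (Ψ : X) :
    Tendsto (fun n => jetIntegral f (Φ n + Ψ) - jetIntegral f (Φ n) - jetIntegral f Ψ) atTop
      (𝓝 0) := by
  have hR : 0 ≤ R := (norm_nonneg _).trans (hΦ 0)
  have hΨ := norm_nonneg Ψ
  set M : ℝ := 4 * (R + ‖Ψ‖)
  have hM : 0 ≤ B M := hB _ (by positivity)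
  have hlim := (tendsto_integral_norm_mul_norm_jetL hΦ h0 Ψ).const_mul (4 * B M)
  rw [mul_zero] at hlim
  refine squeeze_zero_norm (fun n => ?_) hlim
  unfold jetIntegral
  rw [← integral_sub (h.integrable _) (h.integrable _),
    ← integral_sub ((h.integrable _).sub' (h.integrable _)) (h.integrable _),
    ← integral_const_mul]
  refine norm_integral_le_of_norm_le ((integrable_norm_mul_norm_jetL _ _).const_mul _)
    (Eventually.of_forall fun x => ?_)
  have h1 : ‖jetL x (Φ n)‖ ≤ M := (norm_jetL_le x _).trans (by linarith [hΦ n])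
  have h2 : ‖jetL x Ψ‖ ≤ M := (norm_jetL_le x _).trans (by linarith)
  have h3 : ‖jetL x (Φ n + Ψ)‖ ≤ M :=
    (norm_jetL_le x _).trans (by linarith [hΦ n, norm_add_le (Φ n) Ψ])
  rw [map_add] at h3 ⊢
  exact h.abs_add_sub_sub_le hM h1 h2 h3

/-! ### Differentiability of the nonlinear functional -/

namespace Nonlinearity

variable {F : R4 → ℝ} {p q₁ q₂ C : ℝ} (hF : Nonlinearity F p q₁ q₂ C)
include hF

lemma abs_fderiv_jetL_le (Ψ Φ : X) (x : ℝ) : |fderiv ℝ F (jetL x Ψ) (jetL x Φ)|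
    ≤ growthBound q₁ q₂ C (4 * ‖Ψ‖) * (‖jetL x Ψ‖ * ‖jetL x Φ‖) := by
  rw [← mul_assoc]
  exact ((fderiv ℝ F (jetL x Ψ)).le_opNorm _).trans
    (mul_le_mul_of_nonneg_right (hF.norm_fderiv_le (norm_jetL_le x Ψ)) (norm_nonneg _))

lemma integrable_fderiv_jetL (Ψ Φ : X) :
    Integrable (fun x => fderiv ℝ F (jetL x Ψ) (jetL x Φ)) := by
  refine Integrable.mono' ((integrable_norm_mul_norm_jetL Ψ Φ).const_mul _) ?_
    (Eventually.of_forall fun x => hF.abs_fderiv_jetL_le Ψ Φ x)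
  have hc : Continuous fun z : R4 × R4 => fderiv ℝ F z.1 z.2 :=
    (hF.contDiff_fderiv.continuous.comp continuous_fst).clm_apply continuous_snd
  exact hc.comp_aestronglyMeasurable
    ((aestronglyMeasurable_jetL Ψ).prodMk (aestronglyMeasurable_jetL Φ))

/-- The Fréchet derivative of `Ψ ↦ ∫ F(ψ, ψ', v, v')`. -/
def jetIntegralDeriv (Ψ : X) : X →L[ℝ] ℝ :=
  LinearMap.mkContinuous
    { toFun := fun Φ => ∫ x, fderiv ℝ F (jetL x Ψ) (jetL x Φ)
      map_add' := fun Φ₁ Φ₂ => by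
        simp only [map_add]
        exact integral_add (hF.integrable_fderiv_jetL Ψ Φ₁) (hF.integrable_fderiv_jetL Ψ Φ₂)
      map_smul' := fun r Φ => by
        simp only [map_smul]
        exact integral_smul r _ }
    (growthBound q₁ q₂ C (4 * ‖Ψ‖) * (2 * ‖Ψ‖)) (fun Φ => by
      have hn := norm_integral_le_of_norm_le (f := fun x => fderiv ℝ F (jetL x Ψ) (jetL x Φ))
        ((integrable_norm_mul_norm_jetL Ψ Φ).const_mul (growthBound q₁ q₂ C (4 * ‖Ψ‖)))
        (Eventually.of_forall fun x => hF.abs_fderiv_jetL_le Ψ Φ x)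
      refine hn.trans ?_
      rw [integral_const_mul, mul_assoc, mul_assoc]
      exact mul_le_mul_of_nonneg_left (integral_norm_mul_norm_jetL_le Ψ Φ)
        (hF.growthBound_nonneg (by positivity)))

lemma jetIntegralDeriv_apply (Ψ Φ : X) :
    hF.jetIntegralDeriv Ψ Φ = ∫ x, fderiv ℝ F (jetL x Ψ) (jetL x Φ) := rfl

lemma abs_jetIntegral_sub_sub_le {R : ℝ} {Ψ₁ Ψ₂ Ψ : X} (h₁ : ‖Ψ₁‖ ≤ R) (h₂ : ‖Ψ₂‖ ≤ R)
    (h : ‖Ψ‖ ≤ R) :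
    |jetIntegral F Ψ₁ - jetIntegral F Ψ₂ - hF.jetIntegralDeriv Ψ (Ψ₁ - Ψ₂)|
      ≤ growthBound q₁ q₂ C (4 * R) * (2 * (‖Ψ₁ - Ψ‖ + ‖Ψ₂ - Ψ‖) * ‖Ψ₁ - Ψ₂‖) := by
  have hR : 0 ≤ R := (norm_nonneg _).trans h
  have i₁ := hF.quadLip_F.integrable Ψ₁
  have i₂ := hF.quadLip_F.integrable Ψ₂
  have j₁ := integrable_norm_mul_norm_jetL (Ψ₁ - Ψ) (Ψ₁ - Ψ₂)
  have j₂ := integrable_norm_mul_norm_jetL (Ψ₂ - Ψ) (Ψ₁ - Ψ₂)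
  rw [jetIntegralDeriv_apply, jetIntegral, jetIntegral, ← integral_sub i₁ i₂,
    ← integral_sub (i₁.sub' i₂) (hF.integrable_fderiv_jetL Ψ (Ψ₁ - Ψ₂))]
  rw [← Real.norm_eq_abs]
  refine le_trans (norm_integral_le_of_norm_le
    ((j₁.fun_add j₂).const_mul (growthBound q₁ q₂ C (4 * R)))
    (Eventually.of_forall fun x => ?_)) ?_
  · have := hF.abs_sub_sub_fderiv_le (M := 4 * R) ((norm_jetL_le x Ψ₁).trans (by linarith))
      ((norm_jetL_le x Ψ₂).trans (by linarith)) ((norm_jetL_le x Ψ).trans (by linarith))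
    simp only [← map_sub, add_mul] at this
    exact this
  · rw [integral_const_mul]
    refine mul_le_mul_of_nonneg_left ?_ (hF.growthBound_nonneg (by positivity))
    rw [integral_add j₁ j₂]
    linarith [integral_norm_mul_norm_jetL_le (Ψ₁ - Ψ) (Ψ₁ - Ψ₂),
      integral_norm_mul_norm_jetL_le (Ψ₂ - Ψ) (Ψ₁ - Ψ₂)]

lemma hasStrictFDerivAt_jetIntegral (Ψ : X) :
    HasStrictFDerivAt (jetIntegral F) (hF.jetIntegralDeriv Ψ) Ψ := by
  refine .of_isLittleO (Asymptotics.isLittleO_iff.2 fun ε hε => ?_)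
  set A : ℝ := growthBound q₁ q₂ C (4 * (‖Ψ‖ + 1)) with hA
  have hc : Tendsto (fun z : X × X => A * (2 * (‖z.1 - Ψ‖ + ‖z.2 - Ψ‖))) (𝓝 (Ψ, Ψ)) (𝓝 0) := by
    have : Continuous fun z : X × X => A * (2 * (‖z.1 - Ψ‖ + ‖z.2 - Ψ‖)) := by fun_prop
    simpa using this.tendsto (Ψ, Ψ)
  have h1 : ∀ᶠ z : X × X in 𝓝 (Ψ, Ψ), ‖z.1‖ < ‖Ψ‖ + 1 :=
    (continuous_fst.norm.continuousAt).eventually_lt continuousAt_const (by simp)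
  have h2 : ∀ᶠ z : X × X in 𝓝 (Ψ, Ψ), ‖z.2‖ < ‖Ψ‖ + 1 :=
    (continuous_snd.norm.continuousAt).eventually_lt continuousAt_const (by simp)
  filter_upwards [hc.eventually_lt_const hε, h1, h2] with z hz hz1 hz2
  have := hF.abs_jetIntegral_sub_sub_le hz1.le hz2.le (by simp : ‖Ψ‖ ≤ ‖Ψ‖ + 1)
  refine this.trans ?_
  rw [← mul_assoc]
  exact mul_le_mul_of_nonneg_right hz.le (norm_nonneg _)

end Nonlinearity

/-! ### The quadratic part of the action -/

/-- A smooth, coercive, translation invariant quadratic form on the energy space. -/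
structure CoerciveForm (Q : X → ℝ) (κ : ℝ) : Prop where
  pos : 0 < κ
  smul : ∀ (t : ℝ) (Ψ : X), Q (t • Ψ) = t ^ 2 * Q Ψ
  lower : ∀ Ψ : X, κ * ‖Ψ‖ ^ 2 ≤ Q Ψ
  polar : ∀ Ψ : X, ∃ ℓ : X →L[ℝ] ℝ, ∀ Φ : X, Q (Φ + Ψ) = Q Φ + ℓ Φ + Q Ψ
  contDiff : ContDiff ℝ 1 Q
  translate : ∀ (y : ℝ) (Ψ : X), Q (translate y Ψ) = Q Ψ

lemma CoerciveForm.pos_of_ne_zero {Q : X → ℝ} {κ : ℝ} (hQ : CoerciveForm Q κ) {Ψ : X}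
    (hΨ : Ψ ≠ 0) : 0 < Q Ψ := by
  have := hQ.pos
  have := norm_pos_iff.2 hΨ
  exact lt_of_lt_of_le (by positivity) (hQ.lower Ψ)

lemma inner_shift (y : ℝ) (f g : L2) : inner ℝ (shift y f) (shift y g) = inner ℝ f g := by
  rw [← integral_mul_L2, ← integral_mul_L2, ← integral_add_right_eq_self (fun x => f x * g x) y]
  refine integral_congr_ae ?_
  filter_upwards [Lp.coeFn_compMeasurePreserving f (measurePreserving_add_right volume y),
    Lp.coeFn_compMeasurePreserving g (measurePreserving_add_right volume y)] with x hf hg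
  rw [shift, shift, hf, hg]
  rfl

lemma I₁_eq (a c a₂ c₂ : ℝ) (Ψ : X) : I₁ a c a₂ c₂ Ψ =
    inner ℝ (D Ψ.1 0) (D Ψ.1 0) - c * inner ℝ (D Ψ.1 1) (D Ψ.1 1)
      + c₂ * inner ℝ (D Ψ.1 2) (D Ψ.1 2) + inner ℝ (D Ψ.2 0) (D Ψ.2 0)
      - a * inner ℝ (D Ψ.2 1) (D Ψ.2 1) + a₂ * inner ℝ (D Ψ.2 2) (D Ψ.2 2) := by
  have h : ∀ (f : L2) (r : ℝ), Integrable fun x => r * f x ^ 2 :=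
    fun f r => (integrable_sq_L2 f).const_mul r
  have h1 := (integrable_sq_L2 (D Ψ.1 0)).sub' (h (D Ψ.1 1) c)
  have h2 := h1.fun_add (h (D Ψ.1 2) c₂)
  have h3 := h2.fun_add (integrable_sq_L2 (D Ψ.2 0))
  have h4 := h3.sub' (h (D Ψ.2 1) a)
  unfold I₁
  rw [integral_add h4 (h _ _), integral_sub h3 (h _ _), integral_add h2 (integrable_sq_L2 _),
    integral_add h1 (h _ _), integral_sub (integrable_sq_L2 _) (h _ _)]
  simp only [integral_const_mul, integral_sq_L2, real_inner_self_eq_norm_sq]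

lemma I₂_eq (b b₂ : ℝ) (Ψ : X) : I₂ b b₂ Ψ = inner ℝ (D Ψ.1 0) (D Ψ.2 0)
    + b * inner ℝ (D Ψ.1 1) (D Ψ.2 1) + b₂ * inner ℝ (D Ψ.2 2) (D Ψ.1 2) := by
  have h0 := integrable_mul_L2 (D Ψ.1 0) (D Ψ.2 0)
  have h1 := (integrable_mul_L2 (D Ψ.1 1) (D Ψ.2 1)).const_mul b
  have h2 := (integrable_mul_L2 (D Ψ.2 2) (D Ψ.1 2)).const_mul b₂
  unfold I₂
  rw [integral_add (h0.fun_add h1) h2, integral_add h0 h1]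
  simp only [integral_const_mul, integral_mul_L2]

lemma D_add (u v : H2) (i : Fin 3) : D (u + v) i = D u i + D v i := rfl

lemma D_smul (t : ℝ) (u : H2) (i : Fin 3) : D (t • u) i = t • D u i := rfl

lemma D_H2translate (y : ℝ) (u : H2) (i : Fin 3) : D (H2translate y u) i = shift y (D u i) := rfl

/-- The cross term of a quadratic form is linear in `Φ`. Its continuity is what lets the form split
along weakly convergent sequences. -/
lemma exists_polar_I (a b c a₂ b₂ c₂ ω : ℝ) (Ψ : X) : ∃ ℓ : X →L[ℝ] ℝ, ∀ Φ : X,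
    I a b c a₂ b₂ c₂ ω (Φ + Ψ) = I a b c a₂ b₂ c₂ ω Φ + ℓ Φ + I a b c a₂ b₂ c₂ ω Ψ := by
  let ev (i : Fin 3) (f g : L2) : X →L[ℝ] ℝ :=
    (innerSL ℝ f) ∘L derivL i ∘L ContinuousLinearMap.fst ℝ H2 H2
      + (innerSL ℝ g) ∘L derivL i ∘L ContinuousLinearMap.snd ℝ H2 H2
  have hev : ∀ i f g (Φ : X), ev i f g Φ = inner ℝ f (D Φ.1 i) + inner ℝ g (D Φ.2 i) :=
    fun i f g Φ => rfl
  refine ⟨(2 : ℝ) • (ev 0 (D Ψ.1 0) (D Ψ.2 0) - c • ev 1 (D Ψ.1 1) 0 - a • ev 1 0 (D Ψ.2 1)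
    + c₂ • ev 2 (D Ψ.1 2) 0 + a₂ • ev 2 0 (D Ψ.2 2)
    - ω • (ev 0 (D Ψ.2 0) (D Ψ.1 0) + b • ev 1 (D Ψ.2 1) (D Ψ.1 1)
      + b₂ • ev 2 (D Ψ.2 2) (D Ψ.1 2))), fun Φ => ?_⟩
  simp only [I, I₁_eq, I₂_eq, Prod.fst_add, Prod.snd_add, D_add, inner_add_left, inner_add_right,
    smul_apply, add_apply, sub_apply, hev, smul_eq_mul, inner_zero_left]
  rw [real_inner_comm (D Ψ.1 0) (D Φ.1 0), real_inner_comm (D Ψ.1 1) (D Φ.1 1),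
    real_inner_comm (D Ψ.1 2) (D Φ.1 2), real_inner_comm (D Ψ.2 0) (D Φ.2 0),
    real_inner_comm (D Ψ.2 1) (D Φ.2 1), real_inner_comm (D Ψ.2 2) (D Φ.2 2),
    real_inner_comm (D Ψ.2 0) (D Φ.1 0), real_inner_comm (D Ψ.2 1) (D Φ.1 1),
    real_inner_comm (D Ψ.1 2) (D Φ.2 2)]
  ring

lemma contDiff_I (a b c a₂ b₂ c₂ ω : ℝ) : ContDiff ℝ 1 (I a b c a₂ b₂ c₂ ω) := by
  have h1 : ∀ i, ContDiff ℝ 1 fun Ψ : X => D Ψ.1 i := fun i =>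
    (derivL i ∘L ContinuousLinearMap.fst ℝ H2 H2).contDiff
  have h2 : ∀ i, ContDiff ℝ 1 fun Ψ : X => D Ψ.2 i := fun i =>
    (derivL i ∘L ContinuousLinearMap.snd ℝ H2 H2).contDiff
  have he : I a b c a₂ b₂ c₂ ω = fun Ψ : X =>
    (inner ℝ (D Ψ.1 0) (D Ψ.1 0) - c * inner ℝ (D Ψ.1 1) (D Ψ.1 1)
      + c₂ * inner ℝ (D Ψ.1 2) (D Ψ.1 2) + inner ℝ (D Ψ.2 0) (D Ψ.2 0)
      - a * inner ℝ (D Ψ.2 1) (D Ψ.2 1) + a₂ * inner ℝ (D Ψ.2 2) (D Ψ.2 2))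
    + -2 * ω * (inner ℝ (D Ψ.1 0) (D Ψ.2 0)
      + b * inner ℝ (D Ψ.1 1) (D Ψ.2 1) + b₂ * inner ℝ (D Ψ.2 2) (D Ψ.1 2)) := by
    ext Ψ
    rw [I, I₁_eq, I₂_eq]
  rw [he]
  have i1 : ∀ i, ContDiff ℝ 1 fun Ψ : X => inner ℝ (D Ψ.1 i) (D Ψ.1 i) :=
    fun i => (h1 i).inner ℝ (h1 i)
  have i2 : ∀ i, ContDiff ℝ 1 fun Ψ : X => inner ℝ (D Ψ.2 i) (D Ψ.2 i) :=
    fun i => (h2 i).inner ℝ (h2 i)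
  have i3 : ∀ i, ContDiff ℝ 1 fun Ψ : X => inner ℝ (D Ψ.1 i) (D Ψ.2 i) :=
    fun i => (h1 i).inner ℝ (h2 i)
  have i4 : ∀ i, ContDiff ℝ 1 fun Ψ : X => inner ℝ (D Ψ.2 i) (D Ψ.1 i) :=
    fun i => (h2 i).inner ℝ (h1 i)
  fun_prop

lemma abs_mul_inner_le (r : ℝ) (f g : L2) :
    |2 * r * inner ℝ f g| ≤ |r| * (‖f‖ ^ 2 + ‖g‖ ^ 2) := by
  rw [abs_mul, abs_mul, abs_two]
  have h1 := abs_real_inner_le_norm f g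
  have h2 : 2 * |inner ℝ f g| ≤ ‖f‖ ^ 2 + ‖g‖ ^ 2 := by nlinarith [sq_nonneg (‖f‖ - ‖g‖)]
  nlinarith [abs_nonneg r]

lemma exists_coerciveForm_I {a b c a₂ b₂ c₂ ω : ℝ} (hb : 0 < b) (hb₂ : 0 < b₂)
    (hω : |ω| < min 1 (min (-a / b) (min (-c / b) (min (a₂ / b₂) (c₂ / b₂))))) :
    ∃ κ, CoerciveForm (I a b c a₂ b₂ c₂ ω) κ := by
  simp only [lt_min_iff, lt_div_iff₀ hb, lt_div_iff₀ hb₂] at hω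
  obtain ⟨h1, ha, hc, ha₂, hc₂⟩ := hω
  -- Young's inequality charges each cross term equally to its two squares. The entries of this
  -- minimum are the coefficients left over, all positive by the assumption on `ω`.
  set κ := min (1 - |ω|) (min (-a - |ω| * b) (min (-c - |ω| * b)
    (min (a₂ - |ω| * b₂) (c₂ - |ω| * b₂)))) with hκ
  have hκ0 : 0 < κ := by
    simp only [hκ, lt_min_iff]
    refine ⟨?_, ?_, ?_, ?_, ?_⟩ <;> linarith
  have hle := hκ.le
  simp only [le_min_iff] at hle
  obtain ⟨k1, ka, kc, ka₂, kc₂⟩ := hle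
  refine ⟨κ, hκ0, fun t Ψ => ?_, fun Ψ => ?_, exists_polar_I a b c a₂ b₂ c₂ ω,
    contDiff_I a b c a₂ b₂ c₂ ω, fun y Ψ => ?_⟩
  · simp only [I, I₁_eq, I₂_eq, Prod.smul_fst, Prod.smul_snd, D_smul, inner_smul_left,
      inner_smul_right, RCLike.conj_to_real]
    ring
  · have e0 := abs_mul_inner_le ω (D Ψ.1 0) (D Ψ.2 0)
    have e1 := abs_mul_inner_le (ω * b) (D Ψ.1 1) (D Ψ.2 1)
    have e2 := abs_mul_inner_le (ω * b₂) (D Ψ.2 2) (D Ψ.1 2)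
    rw [abs_mul ω b, abs_of_pos hb] at e1
    rw [abs_mul ω b₂, abs_of_pos hb₂] at e2
    have hn : ‖Ψ‖ ^ 2 ≤ ‖Ψ.1‖ ^ 2 + ‖Ψ.2‖ ^ 2 := by
      rw [Prod.norm_def]
      rcases max_choice ‖Ψ.1‖ ‖Ψ.2‖ with h | h <;> rw [h] <;> nlinarith [sq_nonneg ‖Ψ.1‖,
        sq_nonneg ‖Ψ.2‖]
    rw [norm_sq_H2, norm_sq_H2] at hn
    have hn' := mul_le_mul_of_nonneg_left hn hκ0.le
    simp only [I, I₁_eq, I₂_eq, real_inner_self_eq_norm_sq]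
    have m0 := mul_le_mul_of_nonneg_right k1 (sq_nonneg ‖D Ψ.1 0‖)
    have m1 := mul_le_mul_of_nonneg_right kc (sq_nonneg ‖D Ψ.1 1‖)
    have m2 := mul_le_mul_of_nonneg_right kc₂ (sq_nonneg ‖D Ψ.1 2‖)
    have m3 := mul_le_mul_of_nonneg_right k1 (sq_nonneg ‖D Ψ.2 0‖)
    have m4 := mul_le_mul_of_nonneg_right ka (sq_nonneg ‖D Ψ.2 1‖)
    have m5 := mul_le_mul_of_nonneg_right ka₂ (sq_nonneg ‖D Ψ.2 2‖)
    have f0 := (abs_le.1 e0).2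
    have f1 := (abs_le.1 e1).2
    have f2 := (abs_le.1 e2).2
    linarith
  · simp only [I, I₁_eq, I₂_eq, translate, D_H2translate, inner_shift]

/-! ### The action and the Nehari manifold -/

/-- The action `½ Q - K`. -/
def action (Q : X → ℝ) (F : R4 → ℝ) (Ψ : X) : ℝ := 1 / 2 * Q Ψ - K F Ψ

/-- The Nehari functional `Q - N`. -/
def nehari (Q : X → ℝ) (F : R4 → ℝ) (Ψ : X) : ℝ := Q Ψ - N F Ψ

/-- The action corrected by a multiple of the Nehari functional; it is coercive and nondecreasing
along rays, and agrees with the action on the Nehari manifold. -/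
def reducedAction (Q : X → ℝ) (F : R4 → ℝ) (p : ℝ) (Ψ : X) : ℝ :=
  action Q F Ψ - nehari Q F Ψ / (p + 2)

section

variable {F : R4 → ℝ} {p q₁ q₂ C κ : ℝ} {Q : X → ℝ}

lemma action_translate (hQ : CoerciveForm Q κ) (y : ℝ) (Ψ : X) :
    action Q F (translate y Ψ) = action Q F Ψ := by
  simp only [action, K_eq_jetIntegral, jetIntegral_translate, hQ.translate]

lemma nehari_translate (hQ : CoerciveForm Q κ) (y : ℝ) (Ψ : X) :
    nehari Q F (translate y Ψ) = nehari Q F Ψ := by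
  simp only [nehari, N_eq_jetIntegral, jetIntegral_translate, hQ.translate]

lemma continuous_K (hF : Nonlinearity F p q₁ q₂ C) : Continuous (K F) := by
  rw [funext (K_eq_jetIntegral F)]
  exact hF.quadLip_F.continuous_jetIntegral fun _ => hF.growthBound_nonneg

lemma continuous_N (hF : Nonlinearity F p q₁ q₂ C) : Continuous (N F) := by
  rw [funext (N_eq_jetIntegral F)]
  exact hF.quadLip_G.continuous_jetIntegral fun _ => hF.growthBound_nonneg

lemma continuous_nehari (hF : Nonlinearity F p q₁ q₂ C) (hQ : CoerciveForm Q κ) :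
    Continuous (nehari Q F) :=
  hQ.contDiff.continuous.sub (continuous_N hF)

lemma continuous_action (hF : Nonlinearity F p q₁ q₂ C) (hQ : CoerciveForm Q κ) :
    Continuous (action Q F) :=
  (continuous_const.mul hQ.contDiff.continuous).sub (continuous_K hF)

/-- The weight `1/(p+2)` turns the nonlinear part into the integral of `G - (p+2) F`, nonnegative
and monotone along rays, while the coefficient of `Q` stays positive because `p > 0`. -/
lemma reducedAction_eq (hF : Nonlinearity F p q₁ q₂ C) (Ψ : X) :
    reducedAction Q F p Ψ = (1 / 2 - 1 / (p + 2)) * Q Ψ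
      + 1 / (p + 2) * jetIntegral (fun w => G F w - (p + 2) * F w) Ψ := by
  have hp := hF.p_pos
  have h : jetIntegral (fun w => G F w - (p + 2) * F w) Ψ
      = jetIntegral (G F) Ψ - (p + 2) * jetIntegral F Ψ := by
    unfold jetIntegral
    rw [integral_sub (hF.quadLip_G.integrable Ψ) ((hF.quadLip_F.integrable Ψ).const_mul _),
      integral_const_mul]
  rw [h, reducedAction, action, nehari, K_eq_jetIntegral, N_eq_jetIntegral]
  field_simp
  ring

lemma half_sub_inv_pos (hF : Nonlinearity F p q₁ q₂ C) : 0 < 1 / 2 - 1 / (p + 2) := by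
  have hp := hF.p_pos
  rw [sub_pos]
  exact one_div_lt_one_div_of_lt two_pos (by linarith)

lemma le_reducedAction (hF : Nonlinearity F p q₁ q₂ C) (hQ : CoerciveForm Q κ) (Ψ : X) :
    (1 / 2 - 1 / (p + 2)) * κ * ‖Ψ‖ ^ 2 ≤ reducedAction Q F p Ψ := by
  have hp := hF.p_pos
  rw [reducedAction_eq hF, mul_assoc]
  have h1 := mul_le_mul_of_nonneg_left (hQ.lower Ψ) (half_sub_inv_pos hF).le
  have h2 : 0 ≤ jetIntegral (fun w => G F w - (p + 2) * F w) Ψ :=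
    integral_nonneg fun x => sub_nonneg.2 (hF.mul_F_le_G _)
  have h3 : 0 ≤ 1 / (p + 2) := by positivity
  nlinarith [mul_nonneg h3 h2]

lemma reducedAction_smul_le (hF : Nonlinearity F p q₁ q₂ C) (hQ : CoerciveForm Q κ) {t : ℝ}
    (ht0 : 0 < t) (ht : t ≤ 1) (Ψ : X) :
    reducedAction Q F p (t • Ψ) ≤ reducedAction Q F p Ψ := by
  have hp := hF.p_pos
  rw [reducedAction_eq hF, reducedAction_eq hF, hQ.smul]
  have hQ0 : 0 ≤ Q Ψ := le_trans (mul_nonneg hQ.pos.le (sq_nonneg _)) (hQ.lower Ψ)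
  have hi : ∀ Ψ : X, Integrable fun x => G F (jetL x Ψ) - (p + 2) * F (jetL x Ψ) := fun Ψ =>
    (hF.quadLip_G.integrable Ψ).sub' ((hF.quadLip_F.integrable Ψ).const_mul _)
  refine add_le_add (mul_le_mul_of_nonneg_left ?_ (half_sub_inv_pos hF).le)
    (mul_le_mul_of_nonneg_left ?_ (by positivity))
  · exact mul_le_of_le_one_left hQ0 (pow_le_one₀ ht0.le ht)
  · refine integral_mono (hi _) (hi _) fun x => ?_
    simp only [map_smul]
    exact hF.excess_smul_le ht0 ht _

/-! ### Rays and the Nehari manifold -/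

/-- Nonzero states with nonpositive Nehari functional are not uniformly small. -/
lemma exists_le_norm_jetL (hF : Nonlinearity F p q₁ q₂ C) (hQ : CoerciveForm Q κ) :
    ∃ ε > 0, ∀ Ψ : X, Ψ ≠ 0 → nehari Q F Ψ ≤ 0 → ∃ x, ε ≤ ‖jetL x Ψ‖ := by
  have hκ := hQ.pos
  -- If all jets were below such an `ε`, then `N ≤ 2 * growthBound ε * ‖Ψ‖² < κ ‖Ψ‖² ≤ Q`,
  -- contradicting `Q ≤ N`.
  have hev : ∀ᶠ ε : ℝ in 𝓝[>] 0, growthBound q₁ q₂ C ε < κ / 2 :=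
    (hF.tendsto_growthBound.mono_left nhdsWithin_le_nhds).eventually_lt_const (by positivity)
  obtain ⟨ε, hε, hε0⟩ := (hev.and self_mem_nhdsWithin).exists
  refine ⟨ε, hε0, fun Ψ hΨ hneg => ?_⟩
  by_contra! hlt
  have hn : 0 < ‖Ψ‖ ^ 2 := pow_pos (norm_pos_iff.2 hΨ) 2
  have hN : N F Ψ ≤ growthBound q₁ q₂ C ε * (2 * ‖Ψ‖ ^ 2) := by
    rw [N_eq_jetIntegral]
    calc jetIntegral (G F) Ψ ≤ ∫ x, growthBound q₁ q₂ C ε * ‖jetL x Ψ‖ ^ 2 :=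
          integral_mono (hF.quadLip_G.integrable Ψ) ((integrable_norm_sq_jetL Ψ).const_mul _)
            fun x => (le_abs_self _).trans (hF.quadLip_G.abs_le (hlt x).le)
      _ ≤ _ := by
          rw [integral_const_mul]
          exact mul_le_mul_of_nonneg_left (integral_norm_sq_jetL_le Ψ)
            (hF.growthBound_nonneg (le_of_lt hε0))
  have h1 := hQ.lower Ψ
  unfold nehari at hneg
  nlinarith

lemma eventually_nehari_smul_pos (hF : Nonlinearity F p q₁ q₂ C) (hQ : CoerciveForm Q κ) {Ψ : X}
    (hΨ : Ψ ≠ 0) : ∀ᶠ t : ℝ in 𝓝[>] 0, 0 < nehari Q F (t • Ψ) := by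
  obtain ⟨ε, hε, h⟩ := exists_le_norm_jetL hF hQ
  have hn := norm_pos_iff.2 hΨ
  filter_upwards [Ioo_mem_nhdsGT (div_pos hε (by positivity : 0 < 4 * ‖Ψ‖))] with t ht
  by_contra! hneg
  obtain ⟨x, hx⟩ := h (t • Ψ) (smul_ne_zero ht.1.ne' hΨ) hneg
  have h1 := norm_jetL_le x (t • Ψ)
  rw [norm_smul, Real.norm_of_nonneg ht.1.le] at h1
  have h2 := (lt_div_iff₀ (by positivity)).1 ht.2
  linarith

lemma exists_nehari_smul_eq_zero (hF : Nonlinearity F p q₁ q₂ C) (hQ : CoerciveForm Q κ) {Ψ : X}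
    (hΨ : Ψ ≠ 0) (hneg : nehari Q F Ψ ≤ 0) : ∃ t : ℝ, 0 < t ∧ t ≤ 1 ∧ nehari Q F (t • Ψ) = 0 := by
  obtain ⟨s, hs, hs0, hs1⟩ := ((eventually_nehari_smul_pos hF hQ hΨ).and
    (Ioo_mem_nhdsGT one_pos)).exists
  have hc : Continuous fun t : ℝ => nehari Q F (t • Ψ) :=
    (continuous_nehari hF hQ).comp (by fun_prop)
  obtain ⟨t, ht, ht0⟩ := intermediate_value_Icc' hs1.le hc.continuousOn
    (show (0 : ℝ) ∈ Set.Icc _ _ by simpa using ⟨hneg, hs.le⟩)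
  exact ⟨t, hs0.trans_le ht.1, ht.2, ht0⟩

/-- Scaling by some `t ≤ 1` reaches the manifold, where action and reduced action coincide, and the
reduced action does not increase on the way. The bound on the manifold thus extends to the region
inside which remainders will fall. -/
lemma le_reducedAction_of_nehari_nonpos (hF : Nonlinearity F p q₁ q₂ C) (hQ : CoerciveForm Q κ)
    {s : ℝ} (hs : ∀ Ψ : X, nehari Q F Ψ = 0 → Ψ ≠ 0 → s ≤ action Q F Ψ) {Ψ : X} (hΨ : Ψ ≠ 0)
    (hneg : nehari Q F Ψ ≤ 0) : s ≤ reducedAction Q F p Ψ := by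
  obtain ⟨t, ht0, ht1, ht⟩ := exists_nehari_smul_eq_zero hF hQ hΨ hneg
  refine le_trans ?_ (reducedAction_smul_le hF hQ ht0 ht1 Ψ)
  rw [reducedAction, ht, zero_div, sub_zero]
  exact hs _ ht (smul_ne_zero ht0.ne' hΨ)

lemma rpow_mul_N_le (hF : Nonlinearity F p q₁ q₂ C) {t : ℝ} (ht : 1 ≤ t) (Ψ : X) :
    t ^ (p + 2) * N F Ψ ≤ N F (t • Ψ) := by
  rw [N_eq_jetIntegral, N_eq_jetIntegral, jetIntegral, jetIntegral, ← integral_const_mul]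
  refine integral_mono ((hF.quadLip_G.integrable Ψ).const_mul _) (hF.quadLip_G.integrable _)
    fun x => ?_
  simp only [map_smul]
  exact hF.rpow_mul_G_le ht _

lemma N_smul_le (hF : Nonlinearity F p q₁ q₂ C) {t : ℝ} (ht0 : 0 < t) (ht : t ≤ 1) (Ψ : X) :
    N F (t • Ψ) ≤ t ^ (p + 2) * N F Ψ := by
  rw [N_eq_jetIntegral, N_eq_jetIntegral, jetIntegral, jetIntegral, ← integral_const_mul]
  refine integral_mono (hF.quadLip_G.integrable _) ((hF.quadLip_G.integrable Ψ).const_mul _)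
    fun x => ?_
  simp only [map_smul]
  exact hF.G_smul_le ht0 ht _

lemma rpow_add_two {t : ℝ} (ht : 0 < t) (p : ℝ) : t ^ (p + 2) = t ^ 2 * t ^ p := by
  rw [Real.rpow_add ht, Real.rpow_two, mul_comm]

/-- Positivity of `K` forces `N > 0`. Since `N` grows at least like `t ^ (p+2)` and `Q` only like `t
^ 2`, the Nehari functional is nonpositive far out on the ray. -/
lemma exists_nehari_eq_zero (hF : Nonlinearity F p q₁ q₂ C) (hQ : CoerciveForm Q κ) {Ψ : X}
    (hΨ : 0 < K F Ψ) : ∃ Φ : X, nehari Q F Φ = 0 ∧ Φ ≠ 0 := by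
  have hp := hF.p_pos
  have hΨ0 : Ψ ≠ 0 := by
    rintro rfl
    rw [K_eq_jetIntegral, jetIntegral] at hΨ
    simp [hF.zero] at hΨ
  have hN : 0 < N F Ψ := by
    have : (p + 2) * K F Ψ ≤ N F Ψ := by
      rw [K_eq_jetIntegral, N_eq_jetIntegral, jetIntegral, jetIntegral, ← integral_const_mul]
      exact integral_mono ((hF.quadLip_F.integrable Ψ).const_mul _) (hF.quadLip_G.integrable _)
        fun x => hF.mul_F_le_G _
    exact lt_of_lt_of_le (by positivity) this
  obtain ⟨t, ht, ht1⟩ := (((tendsto_rpow_atTop hp).eventually_gt_atTop (Q Ψ / N F Ψ)).and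
    (eventually_ge_atTop 1)).exists
  have ht0 : 0 < t := by linarith
  have hneg : nehari Q F (t • Ψ) ≤ 0 := by
    have h1 := rpow_mul_N_le hF ht1 Ψ
    rw [div_lt_iff₀ hN] at ht
    rw [rpow_add_two ht0, mul_assoc] at h1
    have h2 := mul_le_mul_of_nonneg_left ht.le (sq_nonneg t)
    rw [nehari, hQ.smul]
    linarith
  have hne : t • Ψ ≠ 0 := smul_ne_zero ht0.ne' hΨ0
  obtain ⟨s, hs0, -, hs⟩ := exists_nehari_smul_eq_zero hF hQ hne hneg
  exact ⟨s • t • Ψ, hs, smul_ne_zero hs0.ne' hne⟩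

lemma nehari_smul_pos (hF : Nonlinearity F p q₁ q₂ C) (hQ : CoerciveForm Q κ) {Ψ : X}
    (hΨ : Ψ ≠ 0) (h0 : nehari Q F Ψ = 0) {t : ℝ} (ht0 : 0 < t) (ht : t < 1) :
    0 < nehari Q F (t • Ψ) := by
  have h1 := N_smul_le hF ht0 ht.le Ψ
  have h2 := hQ.pos_of_ne_zero hΨ
  have h3 := Real.rpow_lt_one ht0.le ht hF.p_pos
  rw [rpow_add_two ht0] at h1
  rw [nehari, sub_eq_zero] at h0
  rw [← h0] at h1
  rw [nehari, hQ.smul]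
  have : 0 < t ^ 2 * Q Ψ * (1 - t ^ p) := mul_pos (by positivity) (by linarith)
  linarith

lemma nehari_smul_neg (hF : Nonlinearity F p q₁ q₂ C) (hQ : CoerciveForm Q κ) {Ψ : X}
    (hΨ : Ψ ≠ 0) (h0 : nehari Q F Ψ = 0) {t : ℝ} (ht : 1 < t) :
    nehari Q F (t • Ψ) < 0 := by
  have ht0 : 0 < t := by linarith
  have h1 := rpow_mul_N_le hF ht.le Ψ
  have h2 := hQ.pos_of_ne_zero hΨ
  have h3 := Real.one_lt_rpow ht hF.p_pos
  rw [rpow_add_two ht0] at h1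
  rw [nehari, sub_eq_zero] at h0
  rw [← h0] at h1
  rw [nehari, hQ.smul]
  have : 0 < t ^ 2 * Q Ψ * (t ^ p - 1) := mul_pos (by positivity) (by linarith)
  linarith

/-- A point of the Nehari manifold maximizes the action along its ray. -/
lemma action_smul_le (hF : Nonlinearity F p q₁ q₂ C) (hQ : CoerciveForm Q κ) {Ψ : X}
    (h0 : nehari Q F Ψ = 0) {t : ℝ} (ht : 0 < t) :
    action Q F (t • Ψ) ≤ action Q F Ψ := by
  have hp := hF.p_pos
  have hp2 : 0 < p + 2 := by linarith
  have hQ0 : 0 ≤ Q Ψ := le_trans (mul_nonneg hQ.pos.le (sq_nonneg _)) (hQ.lower Ψ)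
  have hK : (t ^ (p + 2) - 1) / (p + 2) * N F Ψ ≤ K F (t • Ψ) - K F Ψ := by
    rw [K_eq_jetIntegral, K_eq_jetIntegral, N_eq_jetIntegral, jetIntegral, jetIntegral,
      jetIntegral, ← integral_const_mul,
      ← integral_sub (hF.quadLip_F.integrable _) (hF.quadLip_F.integrable _)]
    refine integral_mono ((hF.quadLip_G.integrable Ψ).const_mul _)
      ((hF.quadLip_F.integrable _).sub' (hF.quadLip_F.integrable _)) fun x => ?_
    simp only [map_smul]
    exact hF.F_smul_ge ht _
  -- Bernoulli's inequality for `t ^ 2` with exponent `(p + 2) / 2 ≥ 1`.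
  have hb : (t ^ 2 - 1) / 2 ≤ (t ^ (p + 2) - 1) / (p + 2) := by
    have := one_add_mul_self_le_rpow_one_add (s := t ^ 2 - 1) (by nlinarith [sq_nonneg t])
      (p := (p + 2) / 2) (by linarith)
    rw [add_sub_cancel, ← Real.rpow_natCast, ← Real.rpow_mul ht.le] at this
    rw [show ((2 : ℕ) : ℝ) * ((p + 2) / 2) = p + 2 by push_cast; ring, Real.rpow_natCast] at this
    rw [div_le_div_iff₀ two_pos hp2]
    linarith
  have h1 := mul_le_mul_of_nonneg_right hb hQ0
  rw [nehari, sub_eq_zero] at h0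
  rw [← h0] at hK
  rw [action, action, hQ.smul]
  linarith

/-- A minimizer of the action on the Nehari manifold is a critical point. -/
lemma hasFDerivAt_action_of_isMin (hF : Nonlinearity F p q₁ q₂ C) (hQ : CoerciveForm Q κ)
    {Ψ : X} (hΨ : Ψ ≠ 0) (h0 : nehari Q F Ψ = 0)
    (hmin : ∀ Φ : X, nehari Q F Φ = 0 → Φ ≠ 0 → action Q F Ψ ≤ action Q F Φ) :
    HasFDerivAt (action Q F) (0 : X →L[ℝ] ℝ) Ψ := by
  obtain ⟨L, hL⟩ : ∃ L : X →L[ℝ] ℝ, HasStrictFDerivAt (action Q F) L Ψ := by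
    have hK := hF.hasStrictFDerivAt_jetIntegral Ψ
    rw [← funext (K_eq_jetIntegral F)] at hK
    have h1 : HasStrictFDerivAt Q (fderiv ℝ Q Ψ) Ψ :=
      hQ.contDiff.contDiffAt.hasStrictFDerivAt (by norm_num)
    exact ⟨_, (h1.const_mul (1 / 2 : ℝ)).sub hK⟩
  have key : ∀ Φ : X, 0 ≤ L Φ := by
    intro Φ
    by_contra! hneg
    -- The tolerance keeps the linearization error, at most `η ‖Φ‖` per unit step, below the descent
    -- `-L Φ`.
    set η : ℝ := -L Φ / (2 * (‖Φ‖ + 1)) with hη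
    have hη0 : 0 < η := div_pos (by linarith) (by positivity)
    have hηΦ : η * ‖Φ‖ < -L Φ := by
      rw [hη, div_mul_eq_mul_div, div_lt_iff₀ (by positivity)]
      nlinarith [norm_nonneg Φ]
    -- Strict differentiability is needed: the points compared, `t • (Ψ + s • Φ)` and `t • Ψ`, both
    -- differ from `Ψ` in general.
    have hev := (Asymptotics.isLittleO_iff.1 hL.isLittleO) hη0
    have hcont : Tendsto (fun z : ℝ × ℝ => (z.2 • (Ψ + z.1 • Φ), z.2 • Ψ)) (𝓝 (0, 1))
        (𝓝 (Ψ, Ψ)) := by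
      have : Continuous fun z : ℝ × ℝ => (z.2 • (Ψ + z.1 • Φ), z.2 • Ψ) := by fun_prop
      simpa using this.tendsto (0, 1)
    have hne : ∀ᶠ z : ℝ × ℝ in 𝓝 (0, 1), z.2 • (Ψ + z.1 • Φ) ≠ 0 := by
      have : Continuous fun z : ℝ × ℝ => z.2 • (Ψ + z.1 • Φ) := by fun_prop
      exact this.continuousAt.eventually_ne (by simpa using hΨ)
    obtain ⟨ε, hε, hball⟩ := Metric.eventually_nhds_iff.1 ((hcont.eventually hev).and hne)
    set ε' : ℝ := min (ε / 2) (1 / 2) with hε'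
    have hε'0 : 0 < ε' := lt_min (by positivity) (by norm_num)
    have hε'1 : ε' ≤ 1 / 2 := min_le_right _ _
    have hε'2 : ε' ≤ ε / 2 := min_le_left _ _
    have hpos := nehari_smul_pos hF hQ hΨ h0 (t := 1 - ε') (by linarith) (by linarith)
    have hng := nehari_smul_neg hF hQ hΨ h0 (t := 1 + ε') (by linarith)
    have hc : ∀ t : ℝ, Continuous fun s : ℝ => nehari Q F (t • (Ψ + s • Φ)) := fun t =>
      (continuous_nehari hF hQ).comp (by fun_prop)
    have e1 : ∀ᶠ s : ℝ in 𝓝[>] 0, 0 < nehari Q F ((1 - ε') • (Ψ + s • Φ)) :=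
      (((hc _).tendsto 0).mono_left nhdsWithin_le_nhds).eventually_const_lt (by simpa using hpos)
    have e2 : ∀ᶠ s : ℝ in 𝓝[>] 0, nehari Q F ((1 + ε') • (Ψ + s • Φ)) < 0 :=
      (((hc _).tendsto 0).mono_left nhdsWithin_le_nhds).eventually_lt_const (by simpa using hng)
    obtain ⟨s, hs1, hs2, hs0, hs3⟩ := (e1.and (e2.and (Ioo_mem_nhdsGT hε))).exists
    have hct : Continuous fun t : ℝ => nehari Q F (t • (Ψ + s • Φ)) :=
      (continuous_nehari hF hQ).comp (by fun_prop)
    -- The Nehari functional changes sign across `t = 1` on the ray of `Ψ`, and for small `s` still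
    -- does so on the ray of `Ψ + s • Φ`. Continuity of the constraint suffices to return to the
    -- manifold.
    obtain ⟨t, ht, ht0⟩ := intermediate_value_Icc' (by linarith : 1 - ε' ≤ 1 + ε')
      hct.continuousOn (show (0 : ℝ) ∈ Set.Icc _ _ from ⟨hs2.le, hs1.le⟩)
    have htpos : 0 < t := by linarith [ht.1]
    obtain ⟨hb, hbne⟩ := hball (y := (s, t)) (by
      rw [Prod.dist_eq, max_lt_iff, Real.dist_eq, Real.dist_eq, abs_lt, abs_lt]
      refine ⟨⟨?_, ?_⟩, ?_, ?_⟩ <;> dsimp only <;> linarith [ht.1, ht.2])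
    have h1 := hmin _ ht0 hbne
    have h2 := action_smul_le hF hQ h0 htpos
    have hsub : t • (Ψ + s • Φ) - t • Ψ = (t * s) • Φ := by
      rw [smul_add, add_sub_cancel_left, smul_smul]
    simp only [hsub, map_smul, smul_eq_mul, norm_smul, Real.norm_eq_abs] at hb
    have hts : 0 < t * s := mul_pos htpos hs0
    rw [abs_of_pos hts] at hb
    have h3 := (abs_le.1 hb).2
    -- Contradiction: `action (t(Ψ + sΦ)) < action (tΨ) ≤ action Ψ ≤ action (t(Ψ + sΦ))`, by
    -- descent, maximality on the ray and minimality in turn.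
    nlinarith
  have hL0 : L = 0 := by
    refine ContinuousLinearMap.ext fun Φ => ?_
    have h1 := key Φ
    have h2 := key (-Φ)
    rw [map_neg] at h2
    exact le_antisymm (by simpa using h2) h1
  exact hL0 ▸ hL.hasFDerivAt

/-! ### Compactness of minimizing sequences -/

/-- Minimizing sequences are relatively compact up to translations. -/
lemma exists_translate_tendsto (hF : Nonlinearity F p q₁ q₂ C) (hQ : CoerciveForm Q κ) {s : ℝ}
    (hs : ∀ Ψ : X, nehari Q F Ψ = 0 → Ψ ≠ 0 → s ≤ action Q F Ψ) {Ψ : ℕ → X}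
    (hΨ : ∀ n, nehari Q F (Ψ n) = 0) (hΨ0 : ∀ n, Ψ n ≠ 0)
    (hlim : Tendsto (fun n => action Q F (Ψ n)) atTop (𝓝 s)) :
    ∃ (n : ℕ → ℕ) (y : ℕ → ℝ) (Ψ₀ : X), StrictMono n ∧ Ψ₀ ≠ 0 ∧
      Tendsto (fun k => translate (y k) (Ψ (n k))) atTop (𝓝 Ψ₀) := by
  obtain ⟨ε, hε, hnv⟩ := exists_le_norm_jetL hF hQ
  choose y hy using fun n => hnv (Ψ n) (hΨ0 n) (hΨ n).le
  set θ : ℝ := (1 / 2 - 1 / (p + 2)) * κ with hθ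
  have hθ0 : 0 < θ := mul_pos (half_sub_inv_pos hF) hQ.pos
  have hcoer : ∀ Φ, θ * ‖Φ‖ ^ 2 ≤ reducedAction Q F p Φ := le_reducedAction hF hQ
  set Υ : ℕ → X := fun n => translate (y n) (Ψ n) with hΥ
  have hΥP : ∀ n, nehari Q F (Υ n) = 0 := fun n => by rw [hΥ, nehari_translate hQ, hΨ]
  have hΥL : ∀ n, reducedAction Q F p (Υ n) = action Q F (Ψ n) := fun n => by
    rw [reducedAction, hΥP, zero_div, sub_zero, hΥ, action_translate hQ]
  obtain ⟨A, hA⟩ := hlim.bddAbove_range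
  have hbd : ∀ n, ‖Υ n‖ ≤ Real.sqrt (A / θ) := by
    intro n
    refine Real.le_sqrt_of_sq_le ?_
    rw [le_div_iff₀ hθ0, mul_comm]
    exact (hcoer (Υ n)).trans ((hΥL n).le.trans (hA ⟨n, rfl⟩))
  obtain ⟨Ψ₀, φ, hφ, hweak⟩ := exists_weak_limit_X hbd
  -- After translation the jet at the origin has norm at least `ε`, and its evaluation passes to the
  -- weak limit.
  have hΨ₀ : Ψ₀ ≠ 0 := by
    have h1 := (tendsto_jetL hweak 0).norm
    have h2 : ε ≤ ‖jetL 0 Ψ₀‖ := by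
      refine ge_of_tendsto h1 (Eventually.of_forall fun k => ?_)
      rw [hΥ, jetL_translate, zero_add]
      exact hy _
    rintro rfl
    rw [map_zero, norm_zero] at h2
    linarith
  refine ⟨φ, y ∘ φ, Ψ₀, hφ, hΨ₀, ?_⟩
  set Φ : ℕ → X := fun k => Υ (φ k) - Ψ₀ with hΦ
  have hΦadd : ∀ k, Φ k + Ψ₀ = Υ (φ k) := fun k => by simp [hΦ]
  have hΦbd : ∀ k, ‖Φ k‖ ≤ Real.sqrt (A / θ) + ‖Ψ₀‖ := fun k =>
    (norm_sub_le _ _).trans (add_le_add (hbd _) le_rfl)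
  have hΦjet : ∀ x, Tendsto (fun k => jetL x (Φ k)) atTop (𝓝 0) := by
    intro x
    have := (tendsto_jetL hweak x).sub_const (jetL x Ψ₀)
    simpa [hΦ] using this
  have hB : ∀ M, 0 ≤ M → 0 ≤ growthBound q₁ q₂ C M := fun _ => hF.growthBound_nonneg
  have sK := hF.quadLip_F.tendsto_jetIntegral_split hB hΦbd hΦjet Ψ₀
  have sN := hF.quadLip_G.tendsto_jetIntegral_split hB hΦbd hΦjet Ψ₀
  have sQ : Tendsto (fun k => Q (Φ k + Ψ₀) - Q (Φ k) - Q Ψ₀) atTop (𝓝 0) := by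
    obtain ⟨ℓ, hℓ⟩ := hQ.polar Ψ₀
    have := (hweak ℓ).sub_const (ℓ Ψ₀)
    rw [sub_self] at this
    refine this.congr fun k => ?_
    rw [hℓ, ← map_sub]
    simp only [hΦ]
    ring
  -- The translates lie on the manifold, so the Nehari values of the limit and of the remainder
  -- cancel asymptotically.
  have sP : Tendsto (fun k => nehari Q F (Φ k)) atTop (𝓝 (-nehari Q F Ψ₀)) := by
    have := ((sN.sub sQ).sub_const (nehari Q F Ψ₀))
    simp only [sub_self, zero_sub] at this
    refine this.congr fun k => ?_
    have h := hΥP (φ k)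
    rw [← hΦadd] at h
    simp only [nehari, N_eq_jetIntegral] at h ⊢
    linarith
  have sL : Tendsto (fun k => reducedAction Q F p (Φ k)) atTop
      (𝓝 (s - reducedAction Q F p Ψ₀)) := by
    have h1 : Tendsto (fun k => action Q F (Ψ (φ k))) atTop (𝓝 s) :=
      hlim.comp hφ.tendsto_atTop
    have h2 := (h1.sub (sQ.const_mul (1 / 2 - 1 / (p + 2)))).add
      (sK.sub (sN.const_mul (1 / (p + 2))))
    have h3 := h2.sub_const (reducedAction Q F p Ψ₀)
    simp only [mul_zero, sub_zero, add_zero] at h3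
    refine h3.congr fun k => ?_
    rw [← hΥL, ← hΦadd]
    simp only [reducedAction, action, nehari, N_eq_jetIntegral, K_eq_jetIntegral]
    ring
  -- Either the limit or, eventually, the remainder has nonpositive Nehari functional, and hence
  -- reduced action at least `s`. The two reduced actions sum to `s` asymptotically, so the other
  -- one has nothing left.
  rcases le_or_gt (nehari Q F Ψ₀) 0 with hP | hP
  · have h1 := le_reducedAction_of_nehari_nonpos hF hQ hs hΨ₀ hP
    have h2 : Tendsto (fun k => θ * ‖Φ k‖ ^ 2) atTop (𝓝 0) := by
      rw [show s - reducedAction Q F p Ψ₀ = 0 from le_antisymm (by linarith)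
        (ge_of_tendsto sL (Eventually.of_forall fun k =>
          le_trans (by positivity) (hcoer (Φ k))))] at sL
      exact squeeze_zero (fun k => by positivity) (fun k => hcoer (Φ k)) sL
    have h3 : Tendsto (fun k => ‖Φ k‖ ^ 2) atTop (𝓝 0) := by
      have := h2.const_mul θ⁻¹
      simpa [← mul_assoc, inv_mul_cancel₀ hθ0.ne'] using this
    have h4 : Tendsto (fun k => ‖Φ k‖) atTop (𝓝 0) := by
      simpa using h3.sqrt
    rw [tendsto_iff_norm_sub_tendsto_zero]
    exact h4
  · exfalso
    have h1 : ∀ᶠ k in atTop, nehari Q F (Φ k) < 0 := sP.eventually_lt_const (by linarith)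
    have h2 : ∀ᶠ k in atTop, s ≤ reducedAction Q F p (Φ k) := by
      filter_upwards [h1] with k hk
      refine le_reducedAction_of_nehari_nonpos hF hQ hs ?_ hk.le
      intro h
      -- The remainder is nonzero because the Nehari functional vanishes at zero and is strictly
      -- negative here.
      rw [h, nehari, N_eq_jetIntegral, jetIntegral] at hk
      have hQ0 : Q 0 = 0 := by simpa using hQ.smul 0 0
      simp [hF.quadLip_G.zero, hQ0] at hk
    have h3 := ge_of_tendsto sL h2
    have h4 := hcoer Ψ₀
    have h5 := norm_pos_iff.2 hΨ₀
    have : 0 < θ * ‖Ψ₀‖ ^ 2 := by positivity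
    linarith

end

end Boussinesq

end

/-! ### The main theorem -/

theorem theorem1p1 (a b c a₂ b₂ c₂ ω : ℝ)
    (hb : 0 < b) (hb₂ : 0 < b₂) (ha : a < 0) (hc : c < 0) (ha₂ : 0 < a₂) (hc₂ : 0 < c₂)
    (hω : 0 < |ω|)
    (hω' : |ω| < min 1 (min (-a / b) (min (-c / b) (min (a₂ / b₂) (c₂ / b₂)))))
    (F : Boussinesq.R4 → ℝ) (hF : ContDiff ℝ 2 F) (hF0 : F 0 = 0)
    (hFa : ∃ p : ℝ, 0 < p ∧ ∀ w : Boussinesq.R4,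
      (p + 2) * Boussinesq.G F w ≤ fderiv ℝ (Boussinesq.G F) w w)
    (hFb : ∃ q₁ q₂ C : ℝ, 0 < q₁ ∧ q₁ ≤ q₂ ∧ 0 < C ∧ ∀ w : Boussinesq.R4,
      ‖iteratedFDeriv ℝ 2 F w‖ ≤ C * (‖w‖ ^ q₁ + ‖w‖ ^ q₂))
    (hFc : ∃ u v : Boussinesq.H2, 0 < ∫ x, F (Boussinesq.jet (u, v) x)) :
    (Boussinesq.M a b c a₂ b₂ c₂ ω F \ {0}).Nonempty ∧
    BddBelow (Boussinesq.J a b c a₂ b₂ c₂ ω F ''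
      (Boussinesq.M a b c a₂ b₂ c₂ ω F \ {0})) ∧
    ∀ Ψ : ℕ → Boussinesq.X, Boussinesq.IsMinimizingSeq a b c a₂ b₂ c₂ ω F Ψ →
      ∃ (n : ℕ → ℕ) (y : ℕ → ℝ) (Ψ₀ : Boussinesq.X),
        StrictMono n ∧
        Ψ₀ ∈ Boussinesq.M a b c a₂ b₂ c₂ ω F \ {0} ∧
        Tendsto (fun k => Boussinesq.translate (y k) (Ψ (n k))) atTop (𝓝 Ψ₀) ∧
        Boussinesq.J a b c a₂ b₂ c₂ ω F Ψ₀ = Boussinesq.S a b c a₂ b₂ c₂ ω F ∧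
        IsMinOn (Boussinesq.J a b c a₂ b₂ c₂ ω F) (Boussinesq.M a b c a₂ b₂ c₂ ω F \ {0}) Ψ₀ ∧
        Boussinesq.IsWeakSolution a b c a₂ b₂ c₂ ω F Ψ₀ := by
  open Boussinesq in
  obtain ⟨p, hp, hrad⟩ := hFa
  obtain ⟨q₁, q₂, C, hq₁, hq, hC, hgr⟩ := hFb
  obtain ⟨u, v, huv⟩ := hFc
  have hN : Nonlinearity F p q₁ q₂ C := ⟨hF, hF0, hp, hrad, hq₁, hq, hC, hgr⟩
  obtain ⟨κ, hQ⟩ := exists_coerciveForm_I (c := c) hb hb₂ hω'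
  set Q := I a b c a₂ b₂ c₂ ω with hQdef
  have hbdd : BddBelow (J a b c a₂ b₂ c₂ ω F '' (M a b c a₂ b₂ c₂ ω F \ {0})) := by
    -- Zero is a lower bound because the action is the coercive reduced action on the manifold.
    refine ⟨0, ?_⟩
    rintro _ ⟨Ψ, ⟨hΨ, -⟩, rfl⟩
    have hΨ : nehari Q F Ψ = 0 := hΨ
    have h1 := le_reducedAction hN hQ Ψ
    rw [reducedAction, hΨ, zero_div, sub_zero] at h1
    refine le_trans ?_ h1
    exact mul_nonneg (mul_pos (half_sub_inv_pos hN) hQ.pos).le (sq_nonneg _)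
  refine ⟨?_, hbdd, fun Ψ hΨ => ?_⟩
  · obtain ⟨Φ, h1, h2⟩ := exists_nehari_eq_zero hN hQ (Ψ := (u, v)) huv
    exact ⟨Φ, h1, h2⟩
  have hS : ∀ Φ : X, nehari Q F Φ = 0 → Φ ≠ 0 → S a b c a₂ b₂ c₂ ω F ≤ action Q F Φ :=
    fun Φ h1 h2 => csInf_le hbdd ⟨Φ, ⟨h1, h2⟩, rfl⟩
  obtain ⟨hmem, hlim⟩ := hΨ
  have hmem1 : ∀ n, nehari Q F (Ψ n) = 0 := fun n => (hmem n).1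
  have hmem2 : ∀ n, Ψ n ≠ 0 := fun n => (hmem n).2
  have hlim : Tendsto (fun n => action Q F (Ψ n)) atTop (𝓝 (S a b c a₂ b₂ c₂ ω F)) := hlim
  obtain ⟨n, y, Ψ₀, hn, hΨ₀, hconv⟩ := exists_translate_tendsto hN hQ hS hmem1 hmem2 hlim
  -- Strong convergence keeps the limit on the manifold, since the Nehari functional is continuous
  -- and translation invariant.
  have hP : nehari Q F Ψ₀ = 0 := by
    refine tendsto_nhds_unique (((continuous_nehari hN hQ).tendsto Ψ₀).comp hconv) ?_
    simp [Function.comp_def, nehari_translate hQ, hmem1]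
  have hJ : action Q F Ψ₀ = S a b c a₂ b₂ c₂ ω F := by
    refine tendsto_nhds_unique (((continuous_action hN hQ).tendsto Ψ₀).comp hconv) ?_
    simp only [Function.comp_def, action_translate hQ]
    exact hlim.comp hn.tendsto_atTop
  have hmin : ∀ Φ : X, nehari Q F Φ = 0 → Φ ≠ 0 → action Q F Ψ₀ ≤ action Q F Φ :=
    fun Φ h1 h2 => hJ.trans_le (hS Φ h1 h2)
  exact ⟨n, y, Ψ₀, hn, ⟨hP, hΨ₀⟩, hconv, hJ, fun Φ hΦ => hmin Φ hΦ.1 hΦ.2,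
    hasFDerivAt_action_of_isMin hN hQ hΨ₀ hP hmin⟩
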